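/- **Setting.** Let $(\mathsf X,\mathcal X)$ be a measurable space with countably generated $\sigma$-field, $(\mathsf Y,\mathcal Y)$ a measurable space, $Q$ a Markov kernel on $\mathsf X$, $\nu$ a $\sigma$-finite measure on $\mathsf Y$, and $g:\mathsf X\times\mathsf Y\to[0,\infty)$ measurable with $\int g(x,y)\,\nu(dy)=1$ for all $x$. Put $g_y=g(\cdot,y)$. For $y_k,\dots,y_m\in\mathsf Y$ let $L\langle y_{k:m}\rangle$ be the kernel $$L\langle y_{k:m}\rangle(x_k,A)=\int\!\cdots\!\int \mathbf 1_A(x_{m+1})\prod_{\ell=k}^m g(x_\ell,y_\ell)\,Q(x_\ell,dx_{\ell+1}),$$ with $L\langle y_{k:m}\rangle(x,\cdot)=\delta_x$ if $k>m$. Write $\chi Lf=\iint f(x')\,L(x,dx')\,\chi(dx)$, $\mathbf 1=\mathbf 1_{\mathsf X}$, let $\|\cdot\|_\infty$ be the supremum norm, and set $$\Delta_{\chi,\chi'}\langle y_{k:m}\rangle(f,h)=\chi L\langle y_{k:m}\rangle f\cdot\chi' L\langle y_{k:m}\rangle h-\chi L\langle y_{k:m}\rangle h\cdot\chi' L\langle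 y_{k:m}\rangle f .$$ Let $(Y_n)_{n\in\mathbb Z}$ be a $\mathsf Y$-valued process on a probability space $(\Omega,\mathcal A,\mathbb P)$. For $r\ge1$, a measurable set $C\subseteq\mathsf X$ is *$r$-local Doeblin* if there are positive functions $\epsilon_C^-,\epsilon_C^+$ on $\mathsf Y^r$, probability measures $\lambda_C\langle z\rangle$ with $\lambda_C\langle z\rangle(C)=1$, and positive functions $\varphi_C\langle z\rangle$ on $\mathsf X$ ($z\in\mathsf Y^r$) such that for all $z\in\mathsf Y^r$, $x\in C$ and $A\in\mathcal X$, $$\epsilon_C^-\langle z\rangle\varphi_C\langle z\rangle(x)\lambda_C\langle z\rangle(A)\le L\langle z\rangle(x,A\cap C)\le\epsilon_C^+\langle z\rangle\varphi_C\langle z\rangle(x)\lambda_C\langle z\rangle(A).$$ **Assumptions.** Fix an integer $r\ge1$, a measurable set $K\subseteq\mathsf Y^r$ and a non-empty measurable set $D\subseteq\mathsf X$. (A1) $(Y_n)_{n\in\mathbb Z}$ is strictly stationary and ergodic, and: (i) the process $Z_n=Y_{nr:(n+1)r-1}$, $n\in\mathbb Z$, is ergodic and $\mathbb P(Z_0\in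 K)>2/3$; (ii) for every $\eta>0$ there is an $r$-local Doeblin set $C$ such that $\sup_{x\in C^c}L\langle z\rangle(x,\mathsf X)\le\eta\,\|L\langle z\rangle\mathbf 1\|_\infty<\infty$ for all $z\in K$, and $\inf_{z\in K}\epsilon_C^-\langle z\rangle/\epsilon_C^+\langle z\rangle>0$; (iii) $\mathbb E[\ln^-\inf_{x\in D}L\langle Y_{0:r-1}\rangle(x,D)]<\infty$. (A2) $g(x,y)>0$ for all $(x,y)$, and $\mathbb E[\ln^+\|g_{Y_0}\|_\infty]<\infty$. (The expectations in (A1)(iii) and (A2) are understood to be well defined, that is, the functions of $Y_{0:r-1}$ and of $Y_0$ in them are measurable up to null sets of the laws of these variables.) Let $\mathcal M(D,r)$ be the set of probability measures $\chi$ on $\mathsf X$ with $\mathbb E[\ln^-\chi L\langle Y_{0:\ell-1}\rangle\mathbf 1_D]<\infty$ for all $\ell\in\{0,\dots,r\}$, where $\ln^-0=\infty$. Let $\mathcal P\langle y_{-m:k}\rangle(\chi)$ be the set of probability measures $\tilde\chi$ on $\mathsf X$ with $\|g_{y_k}\|_\infty\,\tilde\chi L\langle y_{-m:k-1}\rangle\mathbf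 1\ge\tfrac12\,\chi L\langle y_{-m:k}\rangle\mathbf 1$. **Proposition.** Assume (A1)–(A2). Then, almost surely, $\chi L\langle Y_{j:j+n-1}\rangle\mathbf 1$ and $\|L\langle Y_{j:j+n-1}\rangle\mathbf 1\|_\infty$ are positive and finite for all $j\in\mathbb Z$, $n\ge0$ and all probability measures $\chi$ on $\mathsf X$ (so the expressions below are well defined), and there is a constant $\beta\in(0,1)$ such that the following hold. (i) For all $\chi,\chi'\in\mathcal M(D,r)$ there is an almost surely finite random variable $C_{\chi,\chi'}$ such that, almost surely, for all integers $k\ge1$, $m\ge0$ and all $\tilde\chi\in\mathcal P\langle Y_{-m:k}\rangle(\chi)$, $$\ln\frac{\tilde\chi L\langle Y_{-m:k}\rangle\mathbf 1}{\tilde\chi L\langle Y_{-m:k-1}\rangle\mathbf 1}-\ln\frac{\chi' L\langle Y_{-m:k}\rangle\mathbf 1}{\chi' L\langle Y_{-m:k-1}\rangle\mathbf 1}\le C_{\chi,\chi'}\,\beta^{k+m}.$$ (ii) For every $\chi\in\mathcal M(D,r)$ there is an almost surely finite random variable $C_\chi$ such that, almost surely, for all integers $k\ge1$, $m\ge0$,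 $$\left|\ln\frac{\chi L\langle Y_{-m:k}\rangle\mathbf 1}{\chi L\langle Y_{-m:k-1}\rangle\mathbf 1}-\ln\frac{\chi L\langle Y_{-m-1:k}\rangle\mathbf 1}{\chi L\langle Y_{-m-1:k-1}\rangle\mathbf 1}\right|\le C_\chi\,\beta^{k+m}.$$ (iii) There is an almost surely finite random variable $C$ such that, almost surely, for all integers $m\ge1$, all probability measures $\chi,\chi'$ on $\mathsf X$ and all bounded measurable $h:\mathsf X\to\mathbb R$, $$\frac{|\Delta_{\chi,\chi'}\langle Y_{-m:-1}\rangle(h,\mathbf 1)|}{\|L\langle Y_{-m:-1}\rangle\mathbf 1\|_\infty^2}\le C\,\beta^m\,\|h\|_\infty.$$ -/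

import Mathlib

open MeasureTheory ProbabilityTheory
open scoped ENNReal NNReal

/-- `ln⁺` on `[0, ∞]`, with `ln⁺ ∞ = ∞`. -/
noncomputable def logPlus (x : ℝ≥0∞) : ℝ≥0∞ := (ENNReal.log x).toENNReal

/-- `ln⁻` on `[0, ∞]`, with `ln⁻ 0 = ∞`. -/
noncomputable def logMinus (x : ℝ≥0∞) : ℝ≥0∞ := (-ENNReal.log x).toENNReal

/-- The vector `(y_j, …, y_{j+n-1})`; it is empty for `n = 0`. -/
def block {E : Type*} (y : ℤ → E) (j : ℤ) (n : ℕ) : Fin n → E := fun i => y (j + (i : ℕ))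

/-- A process indexed by `ℤ` is strictly stationary and ergodic: the shift of sequences preserves
its law on path space and is ergodic for it. -/
def IsStationaryErgodic {Ω E : Type*} [MeasurableSpace Ω] [MeasurableSpace E]
    (P : Measure Ω) (V : ℤ → Ω → E) : Prop :=
  Ergodic (fun (u : ℤ → E) (n : ℤ) => u (n + 1)) (P.map (fun ω n => V n ω))

/-- `E[f(V)] < ∞` for a nonnegative function `f`. As `f` may be a supremum or an infimum over an
uncountable set, that the expectation makes sense (measurability of `f` up to null sets of the law
of `V`) is part of the definition. -/
def HasFiniteExpectation {Ω E : Type*} [MeasurableSpace Ω] [MeasurableSpace E]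
    (P : Measure Ω) (V : Ω → E) (f : E → ℝ≥0∞) : Prop :=
  AEMeasurable f (P.map V) ∧ ∫⁻ ω, f (V ω) ∂P < ∞

/-- A hidden Markov model: a Markov transition kernel `Q` on `X`, and an observation kernel from
`X` to `S` that has the density `y ↦ g x y` with respect to a `σ`-finite measure `ν`. -/
structure HMM (X S : Type*) [MeasurableSpace X] [MeasurableSpace S] where
  Q : Kernel X X
  isMarkovKernel_Q : IsMarkovKernel Q
  ν : Measure S
  sigmaFinite_ν : SigmaFinite ν
  g : X → S → ℝ≥0
  measurable_g : Measurable (Function.uncurry g)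
  lintegral_g : ∀ x, ∫⁻ y, (g x y : ℝ≥0∞) ∂ν = 1

namespace HMM

attribute [instance] HMM.isMarkovKernel_Q HMM.sigmaFinite_ν

variable {X S Ω : Type*} [MeasurableSpace X] [MeasurableSpace S] [MeasurableSpace Ω]

/-- `‖g_y‖_∞`. -/
noncomputable def supG (M : HMM X S) (y : S) : ℝ≥0∞ := ⨆ x, (M.g x y : ℝ≥0∞)

/-- The one-step unnormalized kernel `L⟨y⟩(x, dx') = g(x, y) Q(x, dx')`. -/
noncomputable def step (M : HMM X S) (y : S) : Kernel X X where
  toFun x := (M.g x y : ℝ≥0∞) • M.Q x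
  measurable' := by
    refine Measure.measurable_of_measurable_coe _ fun s hs => ?_
    have h1 : Measurable fun x => (M.g x y : ℝ≥0∞) :=
      (M.measurable_g.comp measurable_prodMk_right).coe_nnreal_ennreal
    exact h1.mul (M.Q.measurable_coe hs)

/-- The unnormalized kernel
`L⟨z⟩(x_0, A) = ∫ ⋯ ∫ 1_A(x_n) ∏_{i < n} g(x_i, z_i) Q(x_i, dx_{i+1})`; for `n = 0` it is the
identity kernel `δ_x`. -/
noncomputable def lkh (M : HMM X S) : {n : ℕ} → (Fin n → S) → Kernel X X
  | 0, _ => Kernel.id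
  | _ + 1, z => (M.lkh (Fin.tail z)) ∘ₖ (M.step (z 0))

/-- The measure `χ L⟨z⟩`. -/
noncomputable def push (M : HMM X S) (χ : ProbabilityMeasure X) {n : ℕ} (z : Fin n → S) :
    Measure X :=
  (χ : Measure X).bind (M.lkh z)

/-- The likelihood `χ L⟨z⟩ 1_X`. -/
noncomputable def lik (M : HMM X S) (χ : ProbabilityMeasure X) {n : ℕ} (z : Fin n → S) : ℝ≥0∞ :=
  M.push χ z Set.univ

/-- `‖L⟨z⟩ 1_X‖_∞`. -/
noncomputable def supLkh (M : HMM X S) {n : ℕ} (z : Fin n → S) : ℝ≥0∞ :=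
  ⨆ x, M.lkh z x Set.univ

/-- The logarithm of the one-step predictive likelihood,
`ln (χ L⟨z_0, …, z_n⟩ 1_X / χ L⟨z_0, …, z_{n-1}⟩ 1_X)`. -/
noncomputable def logPredLik (M : HMM X S) (χ : ProbabilityMeasure X) {n : ℕ}
    (z : Fin (n + 1) → S) : ℝ :=
  Real.log ((M.lik χ z).toReal / (M.lik χ (Fin.init z)).toReal)

/-- `Δ_{χ,χ'}⟨z⟩(f, h) = χ L⟨z⟩ f · χ' L⟨z⟩ h - χ L⟨z⟩ h · χ' L⟨z⟩ f`. -/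
noncomputable def Delta (M : HMM X S) (χ χ' : ProbabilityMeasure X) {n : ℕ} (z : Fin n → S)
    (f h : X → ℝ) : ℝ :=
  (∫ x, f x ∂(M.push χ z)) * (∫ x, h x ∂(M.push χ' z)) -
    (∫ x, h x ∂(M.push χ z)) * (∫ x, f x ∂(M.push χ' z))

/-- The set `𝒫⟨z_0, …, z_n⟩(χ)` of the probability measures `χ̃` such that
`‖g_{z_n}‖_∞ · χ̃ L⟨z_0, …, z_{n-1}⟩ 1_X ≥ (1/2) χ L⟨z_0, …, z_n⟩ 1_X`. -/
def nearSet (M : HMM X S) {n : ℕ} (z : Fin (n + 1) → S) (χ : ProbabilityMeasure X) :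
    Set (ProbabilityMeasure X) :=
  {χt | (1 / 2 : ℝ≥0∞) * M.lik χ z ≤ M.supG (z (Fin.last n)) * M.lik χt (Fin.init z)}

/-- `C` is an `r`-local Doeblin set, with functions `εm = ε⁻`, `εp = ε⁺`, `lam = λ` and `φ`. -/
structure IsLocalDoeblin (M : HMM X S) (r : ℕ) (C : Set X) (εm εp : (Fin r → S) → ℝ≥0)
    (lam : (Fin r → S) → ProbabilityMeasure X) (φ : (Fin r → S) → X → ℝ≥0) : Prop where
  measurableSet : MeasurableSet C
  εm_pos : ∀ z, 0 < εm z
  εp_pos : ∀ z, 0 < εp z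
  φ_pos : ∀ z x, 0 < φ z x
  lam_C : ∀ z, (lam z : Measure X) C = 1
  lower : ∀ z, ∀ x ∈ C, ∀ A, MeasurableSet A →
    (εm z : ℝ≥0∞) * φ z x * (lam z : Measure X) A ≤ M.lkh z x (A ∩ C)
  upper : ∀ z, ∀ x ∈ C, ∀ A, MeasurableSet A →
    M.lkh z x (A ∩ C) ≤ (εp z : ℝ≥0∞) * φ z x * (lam z : Measure X) A

/-- Assumption (A1), for the integer `r` and the sets `K` and `D`. -/
structure AssumptionA1 (M : HMM X S) (P : Measure Ω) (Y : ℤ → Ω → S) (r : ℕ)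
    (K : Set (Fin r → S)) (D : Set X) : Prop where
  stationaryErgodic : IsStationaryErgodic P Y
  r_pos : 0 < r
  measurableSet_K : MeasurableSet K
  blockErgodic :
    IsStationaryErgodic P (fun (n : ℤ) ω => block (fun j => Y j ω) (n * (r : ℤ)) r)
  prob_K : 2 / 3 < P {ω | block (fun j => Y j ω) 0 r ∈ K}
  localDoeblin : ∀ η : ℝ≥0, 0 < η → ∃ C εm εp lam φ, M.IsLocalDoeblin r C εm εp lam φ ∧
    (∀ z ∈ K, (⨆ x ∈ Cᶜ, M.lkh z x Set.univ) ≤ η * M.supLkh z ∧ M.supLkh z < ∞) ∧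
    0 < ⨅ z ∈ K, (εm z : ℝ≥0∞) / (εp z : ℝ≥0∞)
  measurableSet_D : MeasurableSet D
  nonempty_D : D.Nonempty
  minoration : HasFiniteExpectation P (fun ω => block (fun j => Y j ω) 0 r)
    (fun z => logMinus (⨅ x ∈ D, M.lkh z x D))

/-- Assumption (A2). -/
structure AssumptionA2 (M : HMM X S) (P : Measure Ω) (Y : ℤ → Ω → S) : Prop where
  g_pos : ∀ x y, 0 < M.g x y
  supG : HasFiniteExpectation P (Y 0) (fun y => logPlus (M.supG y))

/-- The class `ℳ(D, r)` of the probability measures `χ` such that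
`E[ln⁻ χ L⟨Y_0, …, Y_{ℓ-1}⟩ 1_D] < ∞` for all `ℓ ∈ {0, …, r}`. -/
def initClass (M : HMM X S) (P : Measure Ω) (Y : ℤ → Ω → S) (D : Set X) (r : ℕ) :
    Set (ProbabilityMeasure X) :=
  {χ | ∀ l : ℕ, l ≤ r → ∫⁻ ω, logMinus (M.push χ (block (fun j => Y j ω) 0 l) D) ∂P < ∞}

end HMM

/-! Everything reduces to the antisymmetric expression `a(x) b(x') - b(x) a(x')`, where `b = L⟨z⟩ 1`
and `a = L⟨z⟩ f`, with `f` the last observation density for (i) and (ii), and a test function for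
(iii). It is compared with its symmetric counterpart `a(x) b(x') + b(x) a(x')`. When two copies of
the chain both start in a local Doeblin set `C`, the parts of their laws carried by `C` dominate
multiples of one common measure. The square of that measure gives the two cross terms equal
integrals, so the antisymmetric part loses a factor `ρ = 1 - c²` (`lintegral_cross_contract`). A
pair with a coordinate off `C` does not contract, but for a block in `K` its mass is smaller by a
factor `η`.

`Mixes` records both effects: for every `t`, the antisymmetric part is at most `ρ ^ (p - 2t)` times
the symmetric one plus `η ^ t` times a crude majorant. Going back by one block gains a power of `ρ`
if that block and the next one in time lie in `K` (`Mixes.lintegral_kernel`). Hence `p` is about `N`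
minus twice the number of bad blocks among `N`. As a block is bad with probability below `1/3`,
about a third of the blocks is left, and half of it can be spent on `2t` (`PathControl.two_term`).

The error `η ^ t` must beat the exponential size of the majorants and of the inverse likelihoods. A
maximal ergodic theorem bounds all of these along almost every path by a deterministic linear rate
`c` and a random additive constant (`exists_pathControl`, `exists_initControl`). The likelihoods are
bounded below by paths that lie in `D` at block times (`PathControl.le_lik`,
`PathControl.le_supLkh`). Since `c` is fixed first, `η` can be chosen small in terms of `c`. This
determines `ρ` and a deterministic rate `β`. The finitely many windows too short for the argument
are absorbed in the random constant by `exists_measurable_bound`. -/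

/-! ### Maximal ergodic theorem and one-sided bounds for Birkhoff sums -/

/-- The running maximum `max_{k ≤ n} S_k g` of the Birkhoff sums of `g` along `T`. -/
noncomputable def birkhoffMax {A : Type*} (T : A → A) (g : A → ℝ) : ℕ → A → ℝ
  | 0, _ => 0
  | n + 1, x => max 0 (g x + birkhoffMax T g n (T x))

section BirkhoffMax

variable {A : Type*} {T : A → A} {g : A → ℝ}

lemma birkhoffMax_nonneg (n : ℕ) (x : A) : 0 ≤ birkhoffMax T g n x := by
  cases n <;> simp [birkhoffMax]

lemma birkhoffMax_le_succ (n : ℕ) (x : A) :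
    birkhoffMax T g n x ≤ birkhoffMax T g (n + 1) x := by
  induction n generalizing x with
  | zero => simp [birkhoffMax]
  | succ n ih =>
    rw [birkhoffMax, birkhoffMax]
    gcongr
    exact ih (T x)

lemma birkhoffSum_le_birkhoffMax (n : ℕ) (x : A) :
    birkhoffSum T g n x ≤ birkhoffMax T g n x := by
  induction n generalizing x with
  | zero => simp [birkhoffMax]
  | succ n ih =>
    rw [birkhoffSum_succ', birkhoffMax]
    exact le_max_of_le_right (by gcongr; exact ih (T x))

/-- The recursion moves the bound by a finite amount only. So boundedness is an exactly
`T`-invariant event, to which ergodicity applies. -/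
lemma bddAbove_birkhoffMax_iff (x : A) :
    BddAbove (Set.range fun n => birkhoffMax T g n (T x)) ↔
      BddAbove (Set.range fun n => birkhoffMax T g n x) := by
  constructor
  · rintro ⟨c, hc⟩
    refine ⟨max 0 (g x + c), ?_⟩
    rintro _ ⟨n, rfl⟩
    cases n with
    | zero => simp [birkhoffMax]
    | succ n =>
      simp only [birkhoffMax]
      gcongr
      exact hc ⟨n, rfl⟩
  · rintro ⟨c, hc⟩
    refine ⟨c - g x, ?_⟩
    rintro _ ⟨n, rfl⟩
    have h1 : birkhoffMax T g (n + 1) x ≤ c := hc ⟨n + 1, rfl⟩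
    rw [birkhoffMax] at h1
    have := le_max_right 0 (g x + birkhoffMax T g n (T x))
    simp only
    linarith

variable [MeasurableSpace A]

lemma measurable_birkhoffMax (hT : Measurable T) (hg : Measurable g) (n : ℕ) :
    Measurable (birkhoffMax T g n) := by
  induction n with
  | zero => exact measurable_const
  | succ n ih => exact measurable_const.max (hg.add (ih.comp hT))

lemma integrable_birkhoffMax {μ : Measure A} [IsFiniteMeasure μ] (hT : MeasurePreserving T μ μ)
    (hg : Integrable g μ) (n : ℕ) : Integrable (birkhoffMax T g n) μ := by
  induction n with
  | zero => exact integrable_zero _ _ _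
  | succ n ih => exact (integrable_const 0).sup (hg.add (hT.integrable_comp_of_integrable ih))

/-- A form of the maximal ergodic theorem: for an ergodic transformation, the Birkhoff sums of a
function with negative mean are almost surely bounded above. -/
theorem Ergodic.ae_bddAbove_birkhoffMax {μ : Measure A} [IsProbabilityMeasure μ]
    (hT : Ergodic T μ) (hgm : Measurable g) (hg : Integrable g μ) (hneg : ∫ x, g x ∂μ < 0) :
    ∀ᵐ x ∂μ, BddAbove (Set.range fun n => birkhoffMax T g n x) := by
  set B : Set A := {x | BddAbove (Set.range fun n => birkhoffMax T g n x)} with hB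
  have hTm := hT.toMeasurePreserving
  have hBm : MeasurableSet B :=
    measurableSet_bddAbove_range (measurable_birkhoffMax hTm.measurable hgm)
  have hinv : T ⁻¹' B = B := Set.ext fun x => bddAbove_birkhoffMax_iff x
  rcases hT.toPreErgodic.ae_mem_or_ae_notMem hBm hinv with h | h
  · exact h
  -- Write `M_n` for the running maximum. If it is almost surely unbounded, then `M_n ∘ T → ∞`, and
  -- `M_{n+1} - M_n ∘ T = max (-M_n ∘ T) g` tends to `g`, dominated by `|g|`. By invariance its
  -- integral is `∫ (M_{n+1} - M_n) ≥ 0`, which contradicts the negative mean of `g`.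
  exfalso
  have hlim : Filter.Tendsto (fun n => ∫ x, max (-birkhoffMax T g n (T x)) (g x) ∂μ)
      Filter.atTop (nhds (∫ x, g x ∂μ)) := by
    refine tendsto_integral_of_dominated_convergence (fun x => |g x|) (fun n => ?_) hg.abs
      (fun n => ?_) ?_
    · exact (((measurable_birkhoffMax hTm.measurable hgm n).comp
        hTm.measurable).neg.max hgm).aestronglyMeasurable
    · refine Filter.Eventually.of_forall fun x => ?_
      rw [Real.norm_eq_abs, abs_le]
      have h0 := birkhoffMax_nonneg (T := T) (g := g) n (T x)
      refine ⟨le_max_of_le_right (neg_abs_le _), max_le ?_ (le_abs_self _)⟩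
      linarith [abs_nonneg (g x)]
    · filter_upwards [h] with x hx
      have hx' : ¬ BddAbove (Set.range fun n => birkhoffMax T g n (T x)) := by
        rw [bddAbove_birkhoffMax_iff]; exact hx
      rw [not_bddAbove_iff] at hx'
      obtain ⟨_, ⟨N, rfl⟩, hN⟩ := hx' (-g x)
      refine tendsto_const_nhds.congr' ?_
      filter_upwards [Filter.eventually_ge_atTop N] with n hn
      have := monotone_nat_of_le_succ (fun k => birkhoffMax_le_succ (T := T) (g := g) k (T x)) hn
      rw [max_eq_right]
      simp only at this hN
      linarith
  refine absurd (ge_of_tendsto' hlim fun n => ?_) (not_le.2 hneg)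
  have hM := integrable_birkhoffMax hTm hg
  have e1 : ∀ x, max (-birkhoffMax T g n (T x)) (g x) =
      birkhoffMax T g (n + 1) x - birkhoffMax T g n (T x) := fun x => by
    rw [birkhoffMax, ← max_sub_sub_right]; simp
  simp_rw [e1]
  have hMT : Integrable (fun x => birkhoffMax T g n (T x)) μ :=
    hTm.integrable_comp_of_integrable (hM n)
  rw [integral_sub (hM _) hMT]
  have e2 : ∫ x, birkhoffMax T g n (T x) ∂μ = ∫ x, birkhoffMax T g n x ∂μ := by
    rw [← integral_map (f := birkhoffMax T g n) hTm.measurable.aemeasurable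
      (measurable_birkhoffMax hTm.measurable hgm n).aestronglyMeasurable, hTm.map_eq]
  rw [e2, sub_nonneg]
  exact integral_mono (hM _) (hM _) (birkhoffMax_le_succ n)

/-- A one-sided ergodic bound with a measurable additive constant. -/
theorem Ergodic.exists_birkhoffSum_le {μ : Measure A} [IsProbabilityMeasure μ]
    (hT : Ergodic T μ) {f : A → ℝ} (hfm : Measurable f) (hf : Integrable f μ) {c : ℝ}
    (hc : ∫ x, f x ∂μ < c) :
    ∃ C : A → ℝ, Measurable C ∧ ∀ᵐ x ∂μ, ∀ n : ℕ, birkhoffSum T f n x ≤ c * n + C x := by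
  have hgm : Measurable fun x => f x - c := hfm.sub_const c
  refine ⟨fun x => ⨆ n, birkhoffMax T (fun x => f x - c) n x,
    Measurable.iSup (measurable_birkhoffMax hT.toMeasurePreserving.measurable hgm), ?_⟩
  have hneg : ∫ x, (f x - c) ∂μ < 0 := by
    rw [integral_sub hf (integrable_const c)]; simpa using hc
  filter_upwards [hT.ae_bddAbove_birkhoffMax hgm (hf.sub (integrable_const c)) hneg] with x hx n
  have h1 := (birkhoffSum_le_birkhoffMax n x).trans (le_ciSup hx n)
  have h2 : birkhoffSum T (fun x => f x - c) n x = birkhoffSum T f n x - c * n := by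
    simp [birkhoffSum, Finset.sum_sub_distrib, mul_comm]
  linarith

end BirkhoffMax

/-! ### Two-sided shifts and linear growth along stationary ergodic processes -/

section Shift

variable {E : Type*}

/-- The sequence `u` shiftSeqd by `i`. -/
def shiftSeq (i : ℤ) (u : ℤ → E) : ℤ → E := fun n => u (n + i)

lemma shiftSeq_shiftSeq (i j : ℤ) (u : ℤ → E) :
    shiftSeq i (shiftSeq j u) = shiftSeq (i + j) u := by
  ext n; simp [shiftSeq, add_assoc]

lemma shiftSeq_iterate (i : ℤ) (k : ℕ) (u : ℤ → E) :
    (shiftSeq i)^[k] u = shiftSeq (k * i) u := by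
  induction k with
  | zero => ext n; simp [shiftSeq]
  | succ k ih =>
    rw [Function.iterate_succ_apply', ih, shiftSeq_shiftSeq]
    congr 1; push_cast; ring

lemma sum_range_add_int (F : ℤ → ℝ) (p q : ℕ) :
    ∑ i ∈ Finset.range (p + q), F (-(p : ℤ) + i) =
      ∑ i ∈ Finset.range p, F (-1 - (i : ℤ)) + ∑ i ∈ Finset.range q, F i := by
  rw [Finset.sum_range_add, ← Finset.sum_range_reflect]
  congr 1
  · refine Finset.sum_congr rfl fun i hi => ?_
    rw [Finset.mem_range] at hi
    congr 1; omega
  · refine Finset.sum_congr rfl fun i _ => ?_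
    congr 1; push_cast; ring

variable [MeasurableSpace E]

lemma measurable_shiftSeq (i : ℤ) : Measurable (shiftSeq (E := E) i) :=
  measurable_pi_lambda _ fun n => measurable_pi_apply (n + i)

/-- The shift of two-sided sequences, as a measurable equivalence. -/
def shiftEquiv (E : Type*) [MeasurableSpace E] : (ℤ → E) ≃ᵐ (ℤ → E) where
  toFun := shiftSeq 1
  invFun := shiftSeq (-1)
  left_inv u := by ext n; simp [shiftSeq]
  right_inv u := by ext n; simp [shiftSeq]
  measurable_toFun := measurable_shiftSeq 1
  measurable_invFun := measurable_shiftSeq (-1)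

variable {Ω : Type*} [MeasurableSpace Ω] {P : Measure Ω} {V : ℤ → Ω → E}

lemma IsStationaryErgodic.ergodic_shiftEquiv (h : IsStationaryErgodic P V) :
    Ergodic (shiftEquiv E) (P.map fun ω n => V n ω) := h

lemma IsStationaryErgodic.measurePreserving_shiftSeq (h : IsStationaryErgodic P V) (i : ℤ) :
    MeasurePreserving (shiftSeq i) (P.map fun ω n => V n ω) (P.map fun ω n => V n ω) := by
  obtain ⟨k, rfl | rfl⟩ := i.eq_nat_or_neg
  · have := h.ergodic_shiftEquiv.toMeasurePreserving.iterate k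
    convert this using 1
    ext1 u
    exact (by simpa using (shiftSeq_iterate 1 k u).symm : shiftSeq (k : ℤ) u = (shiftSeq 1)^[k] u)
  · have := h.ergodic_shiftEquiv.symm.toMeasurePreserving.iterate k
    convert this using 1
    ext1 u
    exact (by simpa using (shiftSeq_iterate (-1) k u).symm : shiftSeq (-(k : ℤ)) u = (shiftSeq (-1))^[k] u)

lemma IsStationaryErgodic.map_eq (h : IsStationaryErgodic P V) (hV : ∀ n, Measurable (V n))
    (i : ℤ) : P.map (V i) = P.map (V 0) := by
  have hp : Measurable fun ω n => V n ω := measurable_pi_lambda _ hV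
  have h1 := (h.measurePreserving_shiftSeq i).map_eq
  have h2 := congrArg (Measure.map fun u : ℤ → E => u 0) h1
  rw [Measure.map_map (measurable_pi_apply 0) (measurable_shiftSeq i),
    Measure.map_map ((measurable_pi_apply 0).comp (measurable_shiftSeq i)) hp,
    Measure.map_map (measurable_pi_apply 0) hp] at h2
  have e1 : ((fun u : ℤ → E => u 0) ∘ shiftSeq i) ∘ (fun ω n => V n ω) = V i := by
    ext ω; simp [shiftSeq]
  have e2 : (fun u : ℤ → E => u 0) ∘ (fun ω n => V n ω) = V 0 := by
    ext ω; simp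
  rwa [e1, e2] at h2

variable [IsProbabilityMeasure P]

/-- Two-sided ergodic bound: the sums of `f` along an ergodic shift over the windows `[-p, q)` grow
at most at the rate `c`, for every `c` above the mean of `f`. -/
theorem IsStationaryErgodic.exists_sum_shiftSeq_le (h : IsStationaryErgodic P V)
    (hV : ∀ n, Measurable (V n)) {f : (ℤ → E) → ℝ≥0∞}
    (hf : AEMeasurable f (P.map fun ω n => V n ω)) {c : ℝ}
    (hc : ∫⁻ ω, f (fun n => V n ω) ∂P < ENNReal.ofReal c) :
    ∃ C : Ω → ℝ, Measurable C ∧ ∀ᵐ ω ∂P, (∀ i : ℤ, f (shiftSeq i fun n => V n ω) < ∞) ∧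
      ∀ p q : ℕ, ∑ i ∈ Finset.range (p + q), (f (shiftSeq (-(p : ℤ) + i) fun n => V n ω)).toReal
        ≤ c * (p + q) + C ω := by
  have hp : Measurable fun ω n => V n ω := measurable_pi_lambda _ hV
  set μ := P.map fun ω n => V n ω with hμ
  have : IsProbabilityMeasure μ := Measure.isProbabilityMeasure_map hp.aemeasurable
  have hc' : ∫⁻ u, hf.mk f u ∂μ < ENNReal.ofReal c := by
    rwa [← lintegral_congr_ae hf.ae_eq_mk, lintegral_map' hf hp.aemeasurable]
  have hfin : ∫⁻ u, hf.mk f u ∂μ ≠ ∞ := (hc'.trans ENNReal.ofReal_lt_top).ne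
  have hae : ∀ᵐ u ∂μ, f u = hf.mk f u ∧ hf.mk f u < ∞ :=
    hf.ae_eq_mk.and (ae_lt_top hf.measurable_mk hfin)
  have hae' : ∀ᵐ u ∂μ, ∀ i : ℤ, f (shiftSeq i u) = hf.mk f (shiftSeq i u) ∧
      hf.mk f (shiftSeq i u) < ∞ :=
    ae_all_iff.2 fun i => (h.measurePreserving_shiftSeq i).quasiMeasurePreserving.ae hae
  set F : (ℤ → E) → ℝ := fun u => (hf.mk f u).toReal with hF
  have hFm : Measurable F := hf.measurable_mk.ennreal_toReal
  have hFi : Integrable F μ := integrable_toReal_of_lintegral_ne_top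
    hf.measurable_mk.aemeasurable hfin
  have hFc : ∫ u, F u ∂μ < c := by
    rw [integral_toReal hf.measurable_mk.aemeasurable (ae_lt_top hf.measurable_mk hfin)]
    exact (ENNReal.lt_ofReal_iff_toReal_lt hfin).1 hc'
  obtain ⟨C1, hC1, h1⟩ := h.ergodic_shiftEquiv.exists_birkhoffSum_le hFm hFi hFc
  obtain ⟨C2, hC2, h2⟩ := h.ergodic_shiftEquiv.symm.exists_birkhoffSum_le hFm hFi hFc
  -- The backward sums start at time `-1`, so that time `0` belongs to the forward sums only.
  have h2' := (h.measurePreserving_shiftSeq (-1)).quasiMeasurePreserving.ae h2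
  refine ⟨fun ω => C1 (fun n => V n ω) + C2 (shiftSeq (-1) fun n => V n ω),
    (hC1.comp hp).add (hC2.comp ((measurable_shiftSeq (-1)).comp hp)), ?_⟩
  filter_upwards [ae_of_ae_map hp.aemeasurable (hae'.and (h1.and h2'))] with ω hω
  obtain ⟨ha, hb, hd⟩ := hω
  refine ⟨fun i => by rw [(ha i).1]; exact (ha i).2, fun p q => ?_⟩
  have e0 : ∀ i : ℤ, (f (shiftSeq i fun n => V n ω)).toReal = F (shiftSeq i fun n => V n ω) :=
    fun i => by rw [(ha i).1]
  simp_rw [e0]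
  rw [sum_range_add_int (fun i => F (shiftSeq i fun n => V n ω))]
  have hb' := hb q
  have hd' := hd p
  have e1 : birkhoffSum (shiftEquiv E) F q (fun n => V n ω) =
      ∑ i ∈ Finset.range q, F (shiftSeq i fun n => V n ω) := by
    refine Finset.sum_congr rfl fun i _ => ?_
    have := shiftSeq_iterate 1 i (fun n => V n ω)
    rw [mul_one] at this
    rw [← this]; rfl
  have e2 : birkhoffSum (shiftEquiv E).symm F p (shiftSeq (-1) fun n => V n ω) =
      ∑ i ∈ Finset.range p, F (shiftSeq (-1 - (i : ℤ)) fun n => V n ω) := by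
    refine Finset.sum_congr rfl fun i _ => ?_
    have := shiftSeq_iterate (-1) i (shiftSeq (-1) fun n => V n ω)
    rw [shiftSeq_shiftSeq] at this
    rw [show (-1 - (i : ℤ)) = i * (-1) + -1 by ring, ← this]; rfl
  rw [e1] at hb'
  rw [e2] at hd'
  linarith

/-- An integrable function along an ergodic shift grows slower than any linear function. -/
theorem IsStationaryErgodic.exists_shiftSeq_neg_le (h : IsStationaryErgodic P V)
    (hV : ∀ n, Measurable (V n)) {f : (ℤ → E) → ℝ≥0∞} (hf : Measurable f)
    (hfin : ∫⁻ ω, f (fun n => V n ω) ∂P < ∞) {ε : ℝ} (hε : 0 < ε) :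
    ∃ C : Ω → ℝ, Measurable C ∧ ∀ᵐ ω ∂P, ∀ m : ℕ, f (shiftSeq (-(m : ℤ)) fun n => V n ω) < ∞ ∧
      (f (shiftSeq (-(m : ℤ)) fun n => V n ω)).toReal ≤ ε * m + C ω := by
  have hp : Measurable fun ω n => V n ω := measurable_pi_lambda _ hV
  -- Truncation: the excess of `f` over a large `N` has mean below `ε`, so its window sums grow at
  -- rate `ε`. A single term is bounded by the whole sum.
  have hlim : Filter.Tendsto (fun N : ℕ => ∫⁻ ω, (f (fun n => V n ω) - N) ∂P) Filter.atTop
      (nhds (∫⁻ _, 0 ∂P)) := by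
    refine tendsto_lintegral_of_dominated_convergence (fun ω => f (fun n => V n ω))
      (fun N => (hf.comp hp).sub measurable_const) (fun N => ?_) hfin.ne ?_
    · exact Filter.Eventually.of_forall fun ω => tsub_le_self
    · filter_upwards [ae_lt_top (hf.comp hp) hfin.ne] with ω hω
      obtain ⟨N, hN⟩ := ENNReal.exists_nat_gt hω.ne
      refine tendsto_const_nhds.congr' ?_
      filter_upwards [Filter.eventually_ge_atTop N] with n hn
      have : f (fun n => V n ω) ≤ n := hN.le.trans (by exact_mod_cast hn)
      exact (tsub_eq_zero_of_le this).symm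
  rw [lintegral_zero] at hlim
  obtain ⟨N, hN⟩ := (hlim.eventually (gt_mem_nhds (ENNReal.ofReal_pos.2 hε))).exists
  obtain ⟨C, hC, hω⟩ := h.exists_sum_shiftSeq_le hV (f := fun u => f u - N)
    (hf.sub measurable_const).aemeasurable hN
  refine ⟨fun ω => C ω + N + ε, (hC.add_const _).add_const _, ?_⟩
  filter_upwards [hω] with ω hω m
  obtain ⟨h1, h2⟩ := hω
  -- The window `[-m, 1)` begins with the wanted term. Its `m + 1` indices account for the extra `ε`
  -- in the constant.
  have h3 := h2 m 1
  have h4 : (f (shiftSeq (-(m : ℤ)) fun n => V n ω) - N).toReal ≤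
      ∑ i ∈ Finset.range (m + 1),
        (f (shiftSeq (-(m : ℤ) + i) fun n => V n ω) - N).toReal := by
    have := Finset.single_le_sum (f := fun i : ℕ =>
      (f (shiftSeq (-(m : ℤ) + i) fun n => V n ω) - N).toReal)
      (fun i _ => ENNReal.toReal_nonneg) (Finset.mem_range.2 (Nat.succ_pos m))
    simpa using this
  have h5 : f (shiftSeq (-(m : ℤ)) fun n => V n ω) ≤
      (f (shiftSeq (-(m : ℤ)) fun n => V n ω) - N) + N := le_tsub_add
  have h6 : (f (shiftSeq (-(m : ℤ)) fun n => V n ω) - N) + N < ∞ :=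
    ENNReal.add_lt_top.2 ⟨h1 _, ENNReal.natCast_lt_top N⟩
  refine ⟨h5.trans_lt h6, ?_⟩
  have h7 := ENNReal.toReal_mono h6.ne h5
  rw [ENNReal.toReal_add (h1 _).ne (ENNReal.natCast_ne_top N), ENNReal.toReal_natCast] at h7
  push_cast at h3
  linarith

end Shift

/-! ### Blocks of observations and the action of the unnormalized kernels -/

section Block

variable {E : Type*} (y : ℤ → E)

lemma tail_block (j : ℤ) (n : ℕ) : Fin.tail (block y j (n + 1)) = block y (j + 1) n := by
  ext i; simp only [Fin.tail, block, Fin.val_succ]; congr 1; push_cast; ring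

lemma init_block (j : ℤ) (n : ℕ) : Fin.init (block y j (n + 1)) = block y j n := by
  ext i; simp [Fin.init, block]

lemma block_zero (j : ℤ) (n : ℕ) : block y j (n + 1) 0 = y j := by
  simp [block]

lemma block_last (j : ℤ) (n : ℕ) : block y j (n + 1) (Fin.last n) = y (j + n) := by
  simp [block]

lemma block_shiftSeq (i j : ℤ) (n : ℕ) : block (shiftSeq i y) j n = block y (j + i) n := by
  ext k; simp only [block, shiftSeq]; congr 1; ring

lemma measurable_block [MeasurableSpace E] (j : ℤ) (n : ℕ) :
    Measurable fun y : ℤ → E => block y j n :=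
  measurable_pi_lambda _ fun i => measurable_pi_apply (j + (i : ℕ))

end Block

namespace HMM

variable {X S Ω : Type*} [MeasurableSpace X] [MeasurableSpace S] [MeasurableSpace Ω]
  (M : HMM X S)

lemma measurable_g_left (y : S) : Measurable fun x => (M.g x y : ℝ≥0∞) :=
  (M.measurable_g.comp measurable_prodMk_right).coe_nnreal_ennreal

lemma lintegral_step (y : S) (x : X) (f : X → ℝ≥0∞) :
    ∫⁻ x', f x' ∂M.step y x = M.g x y * ∫⁻ x', f x' ∂M.Q x :=
  lintegral_smul_measure _ f

lemma lkh_succ_apply {n : ℕ} (z : Fin (n + 1) → S) (x : X) {A : Set X} (hA : MeasurableSet A) :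
    M.lkh z x A = M.g x (z 0) * ∫⁻ x', M.lkh (Fin.tail z) x' A ∂M.Q x := by
  rw [lkh, Kernel.comp_apply' _ _ _ hA, lintegral_step]

/-- Joint measurability makes the likelihoods random variables once `x` is integrated out. In the
induction, `Q` is viewed as a kernel that ignores the observation coordinates. -/
lemma measurable_lkh_joint {n : ℕ} {A : Set X} (hA : MeasurableSet A) :
    Measurable fun p : (Fin n → S) × X => M.lkh p.1 p.2 A := by
  induction n with
  | zero =>
    have : (fun p : (Fin 0 → S) × X => M.lkh p.1 p.2 A) =
        fun p => (Kernel.id : Kernel X X) p.2 A := rfl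
    rw [this]
    exact (Kernel.measurable_coe _ hA).comp measurable_snd
  | succ n ih =>
    simp_rw [M.lkh_succ_apply _ _ hA]
    have h0 : Measurable fun p : (Fin (n + 1) → S) × X => (M.g p.2 (p.1 0) : ℝ≥0∞) :=
      (M.measurable_g.comp (measurable_snd.prodMk
        ((measurable_pi_apply 0).comp measurable_fst))).coe_nnreal_ennreal
    refine h0.mul ?_
    have ht : Measurable fun z : Fin (n + 1) → S => Fin.tail z :=
      measurable_pi_lambda _ fun i => measurable_pi_apply i.succ
    have hf : Measurable fun q : ((Fin (n + 1) → S) × X) × X => M.lkh (Fin.tail q.1.1) q.2 A :=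
      ih.comp ((ht.comp (measurable_fst.comp measurable_fst)).prodMk measurable_snd)
    exact Measurable.lintegral_kernel_prod_right' (κ := M.Q.comap Prod.snd measurable_snd) hf

lemma push_apply (χ : ProbabilityMeasure X) {n : ℕ} (z : Fin n → S) {A : Set X}
    (hA : MeasurableSet A) : M.push χ z A = ∫⁻ x, M.lkh z x A ∂(χ : Measure X) :=
  Measure.bind_apply hA (Kernel.measurable _).aemeasurable

lemma measurable_push (χ : ProbabilityMeasure X) {n : ℕ} {A : Set X} (hA : MeasurableSet A) :
    Measurable fun z : Fin n → S => M.push χ z A := by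
  simp_rw [M.push_apply χ _ hA]
  exact (M.measurable_lkh_joint hA).lintegral_prod_right'

lemma measurable_lik (χ : ProbabilityMeasure X) {n : ℕ} :
    Measurable fun z : Fin n → S => M.lik χ z :=
  M.measurable_push χ MeasurableSet.univ

lemma measurable_logPredLik (χ : ProbabilityMeasure X) {n : ℕ} :
    Measurable fun z : Fin (n + 1) → S => M.logPredLik χ z := by
  have hi : Measurable fun z : Fin (n + 1) → S => Fin.init z :=
    measurable_pi_lambda _ fun i => measurable_pi_apply i.castSucc
  exact Real.measurable_log.comp ((M.measurable_lik χ).ennreal_toReal.div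
    ((M.measurable_lik χ).comp hi).ennreal_toReal)

/-- The function `L⟨y_j, …, y_{j+n-1}⟩ f`. -/
noncomputable def act (y : ℤ → S) (j : ℤ) (n : ℕ) (f : X → ℝ≥0∞) (x : X) : ℝ≥0∞ :=
  ∫⁻ x', f x' ∂M.lkh (block y j n) x

variable (y : ℤ → S)

lemma measurable_act (j : ℤ) (n : ℕ) {f : X → ℝ≥0∞} (hf : Measurable f) :
    Measurable (M.act y j n f) :=
  hf.lintegral_kernel

lemma act_zero (j : ℤ) {f : X → ℝ≥0∞} (hf : Measurable f) : M.act y j 0 f = f := by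
  ext x
  exact lintegral_dirac' x hf

lemma act_succ (j : ℤ) (n : ℕ) {f : X → ℝ≥0∞} (hf : Measurable f) (x : X) :
    M.act y j (n + 1) f x = M.g x (y j) * ∫⁻ x', M.act y (j + 1) n f x' ∂M.Q x := by
  rw [act, lkh, Kernel.lintegral_comp _ _ _ hf, lintegral_step, tail_block, block_zero]
  rfl

lemma act_add (j : ℤ) (n m : ℕ) {f : X → ℝ≥0∞} (hf : Measurable f) :
    M.act y j (n + m) f = M.act y j n (M.act y (j + n) m f) := by
  induction n generalizing j with
  | zero => rw [act_zero _ _ _ (M.measurable_act _ _ _ hf)]; simp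
  | succ n ih =>
    ext x
    rw [show n + 1 + m = (n + m) + 1 by ring, act_succ _ _ _ _ hf,
      act_succ _ _ _ _ (M.measurable_act _ _ _ hf), ih]
    push_cast
    rw [show j + 1 + (n : ℤ) = j + (n + 1) by ring]

lemma act_one (j : ℤ) (n : ℕ) (x : X) :
    M.act y j n (fun _ => 1) x = M.lkh (block y j n) x Set.univ := by
  simp [act]

lemma act_const_mul (j : ℤ) (n : ℕ) (c : ℝ≥0∞) {f : X → ℝ≥0∞} (hf : Measurable f) (x : X) :
    M.act y j n (fun x => c * f x) x = c * M.act y j n f x :=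
  lintegral_const_mul c hf

lemma act_mono (j : ℤ) (n : ℕ) {f h : X → ℝ≥0∞} (hfh : ∀ x, f x ≤ h x) (x : X) :
    M.act y j n f x ≤ M.act y j n h x :=
  lintegral_mono hfh

lemma act_indicator (j : ℤ) (n : ℕ) {A : Set X} (hA : MeasurableSet A) (x : X) :
    M.act y j n (A.indicator 1) x = M.lkh (block y j n) x A :=
  lintegral_indicator_one hA

lemma act_step_one (j : ℤ) (x : X) : M.act y j 1 (fun _ => 1) x = M.g x (y j) := by
  rw [act_succ _ _ _ _ measurable_const, act_zero _ _ _ measurable_const]; simp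

/-- One more factor is the same as testing against the last observation density. -/
lemma act_succ_one (j : ℤ) (n : ℕ) :
    M.act y j (n + 1) (fun _ => 1) = M.act y j n fun x => (M.g x (y (j + n)) : ℝ≥0∞) := by
  rw [act_add _ _ _ _ _ measurable_const]
  congr 1
  ext x
  exact M.act_step_one y _ x

lemma lintegral_push (χ : ProbabilityMeasure X) (j : ℤ) (n : ℕ) {f : X → ℝ≥0∞}
    (hf : Measurable f) :
    ∫⁻ x, f x ∂M.push χ (block y j n) = ∫⁻ x, M.act y j n f x ∂(χ : Measure X) :=
  Measure.lintegral_bind (Kernel.measurable _).aemeasurable hf.aemeasurable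

lemma lik_eq (χ : ProbabilityMeasure X) (j : ℤ) (n : ℕ) :
    M.lik χ (block y j n) = ∫⁻ x, M.act y j n (fun _ => 1) x ∂(χ : Measure X) := by
  rw [← lintegral_push _ _ _ _ _ measurable_const, lintegral_one]; rfl

lemma lik_add (χ : ProbabilityMeasure X) (j : ℤ) (n m : ℕ) :
    M.lik χ (block y j (n + m)) =
      ∫⁻ x, M.act y (j + n) m (fun _ => 1) x ∂M.push χ (block y j n) := by
  rw [lik_eq, act_add _ _ _ _ _ measurable_const,
    lintegral_push _ _ _ _ _ (M.measurable_act _ _ _ measurable_const)]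

lemma lik_succ (χ : ProbabilityMeasure X) (j : ℤ) (n : ℕ) :
    M.lik χ (block y j (n + 1)) =
      ∫⁻ x, M.act y j n (fun x => (M.g x (y (j + n)) : ℝ≥0∞)) x ∂(χ : Measure X) := by
  rw [lik_eq, act_succ_one]

/-- The product of the numbers `max 1 ‖g_{y_i}‖_∞` over the window `[j, j + n)`. -/
noncomputable def majorant (j : ℤ) (n : ℕ) : ℝ≥0∞ :=
  ∏ i ∈ Finset.range n, max 1 (M.supG (y (j + i)))

lemma majorant_add (j : ℤ) (n m : ℕ) :
    M.majorant y j (n + m) = M.majorant y j n * M.majorant y (j + n) m := by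
  rw [majorant, Finset.prod_range_add]
  congr 1
  refine Finset.prod_congr rfl fun i _ => ?_
  push_cast; rw [add_assoc]

lemma one_le_majorant (j : ℤ) (n : ℕ) : 1 ≤ M.majorant y j n :=
  Finset.one_le_prod' fun _ _ => le_max_left _ _

lemma majorant_one (j : ℤ) : M.majorant y j 1 = max 1 (M.supG (y j)) := by
  simp [majorant]

lemma supG_le_majorant (j : ℤ) : M.supG (y j) ≤ M.majorant y j 1 := by
  rw [majorant_one]; exact le_max_right _ _

/-- All factors are at least `1`, so enlarging a window can only increase the product. Every window
can thus be compared with one of the form `[-p, q)`. -/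
lemma majorant_le_of_le {j j' : ℤ} {n n' : ℕ} (h1 : j ≤ j') (h2 : j' + n' ≤ j + n) :
    M.majorant y j' n' ≤ M.majorant y j n := by
  obtain ⟨k, hk⟩ := Int.le.dest h1
  obtain ⟨l, hl⟩ := Int.le.dest h2
  have hn : n = k + n' + l := by omega
  subst hk
  rw [hn, majorant_add, majorant_add]
  calc M.majorant y (j + k) n' = 1 * M.majorant y (j + k) n' * 1 := by simp
    _ ≤ _ := by gcongr <;> exact M.one_le_majorant _ _ _

lemma act_le (j : ℤ) (n : ℕ) {f : X → ℝ≥0∞} (hf : Measurable f) {c : ℝ≥0∞}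
    (hc : ∀ x, f x ≤ c) (x : X) : M.act y j n f x ≤ M.majorant y j n * c := by
  induction n generalizing j x with
  | zero => simpa [act_zero _ _ _ hf, majorant] using hc x
  | succ n ih =>
    rw [act_succ _ _ _ _ hf, add_comm n 1, majorant_add, mul_assoc]
    refine mul_le_mul' ((le_iSup (fun x => (M.g x (y j) : ℝ≥0∞)) x).trans
      (M.supG_le_majorant y j)) ?_
    calc ∫⁻ x', M.act y (j + 1) n f x' ∂M.Q x
        ≤ ∫⁻ _, M.majorant y (j + 1) n * c ∂M.Q x := lintegral_mono fun x' => ih _ x'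
      _ = _ := by simp

lemma lkh_univ_le (j : ℤ) (n : ℕ) (x : X) :
    M.lkh (block y j n) x Set.univ ≤ M.majorant y j n := by
  rw [← act_one]
  simpa using M.act_le y j n measurable_const (fun _ => le_refl (1 : ℝ≥0∞)) x

lemma supLkh_le_majorant (j : ℤ) (n : ℕ) : M.supLkh (block y j n) ≤ M.majorant y j n :=
  iSup_le fun x => M.lkh_univ_le y j n x

lemma push_univ_le (χ : ProbabilityMeasure X) (j : ℤ) (n : ℕ) :
    M.push χ (block y j n) Set.univ ≤ M.majorant y j n := by
  rw [push_apply _ _ _ MeasurableSet.univ]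
  calc _ ≤ ∫⁻ _, M.majorant y j n ∂(χ : Measure X) :=
        lintegral_mono fun x => M.lkh_univ_le y j n x
    _ = _ := by simp

lemma act_pos (hg : ∀ x y, 0 < M.g x y) (j : ℤ) (n : ℕ) {f : X → ℝ≥0∞} (hf : Measurable f)
    (hpos : ∀ x, 0 < f x) (x : X) : 0 < M.act y j n f x := by
  induction n generalizing j x with
  | zero => simpa [act_zero _ _ _ hf] using hpos x
  | succ n ih =>
    rw [act_succ _ _ _ _ hf]
    refine ENNReal.mul_pos (by simpa using (hg x _).ne') ?_
    refine (lintegral_pos_iff_support (M.measurable_act _ _ _ hf)).2 ?_ |>.ne'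
    have : Function.support (M.act y (j + 1) n f) = Set.univ :=
      Set.eq_univ_of_forall fun x' => (ih _ x').ne'
    simp [this]

lemma lik_pos (hg : ∀ x y, 0 < M.g x y) (χ : ProbabilityMeasure X) (j : ℤ) (n : ℕ) :
    0 < M.lik χ (block y j n) := by
  rw [lik_eq]
  refine (lintegral_pos_iff_support (M.measurable_act _ _ _ measurable_const)).2 ?_
  have : Function.support (M.act y j n fun _ => 1) = Set.univ :=
    Set.eq_univ_of_forall fun x' => (M.act_pos y hg _ _ measurable_const (by simp) x').ne'
  simp [this]

lemma lik_le_supLkh (χ : ProbabilityMeasure X) {n : ℕ} (z : Fin n → S) :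
    M.lik χ z ≤ M.supLkh z := by
  rw [lik, push_apply _ _ _ MeasurableSet.univ]
  calc _ ≤ ∫⁻ _, M.supLkh z ∂(χ : Measure X) :=
        lintegral_mono fun x => le_iSup (fun x => M.lkh z x Set.univ) x
    _ = _ := by simp

end HMM

/-! ### Contraction of antisymmetric expressions -/

section Contraction

variable {X : Type*} [MeasurableSpace X]

/-- The bound is integrated against `μ × μ'`, where all cross terms factor. Nothing is gained here
except that the error `H` is weighted by the masses. -/
lemma lintegral_cross_le {μ μ' : Measure X} [IsFiniteMeasure μ] [IsFiniteMeasure μ']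
    {a b : X → ℝ≥0∞} (ha : Measurable a) (hb : Measurable b) {θ H : ℝ≥0∞}
    (h : ∀ x x', a x * b x' ≤ b x * a x' + θ * (a x * b x' + b x * a x') + H) :
    (∫⁻ x, a x ∂μ) * ∫⁻ x, b x ∂μ' ≤ (∫⁻ x, b x ∂μ) * (∫⁻ x, a x ∂μ') +
      θ * ((∫⁻ x, a x ∂μ) * (∫⁻ x, b x ∂μ') + (∫⁻ x, b x ∂μ) * ∫⁻ x, a x ∂μ') +
      H * (μ Set.univ * μ' Set.univ) := by
  have hab : Measurable fun p : X × X => a p.1 * b p.2 :=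
    (ha.comp measurable_fst).mul (hb.comp measurable_snd)
  have hba : Measurable fun p : X × X => b p.1 * a p.2 :=
    (hb.comp measurable_fst).mul (ha.comp measurable_snd)
  have hG : Measurable fun p : X × X => a p.1 * b p.2 + b p.1 * a p.2 := hab.add hba
  have h1 := lintegral_mono (μ := μ.prod μ') fun p : X × X => h p.1 p.2
  rw [lintegral_add_right _ measurable_const, lintegral_add_left hba,
    lintegral_const_mul _ hG, lintegral_add_left hab, lintegral_const,
    lintegral_prod_mul ha.aemeasurable hb.aemeasurable,
    lintegral_prod_mul hb.aemeasurable ha.aemeasurable, ← Set.univ_prod_univ,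
    Measure.prod_prod] at h1
  exact h1

/-- Contraction of antisymmetric functions: two measures that are comparable to multiples of the
same measure `l` lose the part of their product that `l × l` carries. -/
lemma lintegral_cross_contract {μ μ' l : Measure X} [IsFiniteMeasure μ] [IsFiniteMeasure μ']
    [IsFiniteMeasure l] {α α' : ℝ≥0} {c ρ : ℝ≥0∞} (hρ : ρ + c * c = 1)
    (h1 : (α : ℝ≥0∞) • l ≤ μ) (h2 : c • μ ≤ (α : ℝ≥0∞) • l)
    (h1' : (α' : ℝ≥0∞) • l ≤ μ') (h2' : c • μ' ≤ (α' : ℝ≥0∞) • l)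
    {a b : X → ℝ≥0∞} (ha : Measurable a) (hb : Measurable b)
    (haf : ∫⁻ x, a x ∂l ≠ ∞) (hbf : ∫⁻ x, b x ∂l ≠ ∞)
    {K : X × X → ℝ≥0∞} (hK : Measurable K) (hKf : ∫⁻ p, K p ∂(μ.prod μ') ≠ ∞)
    (hle : ∀ᵐ p ∂(μ.prod μ'), a p.1 * b p.2 ≤ b p.1 * a p.2 + K p) :
    ∫⁻ p, a p.1 * b p.2 ∂(μ.prod μ') ≤
      ∫⁻ p, b p.1 * a p.2 ∂(μ.prod μ') + ρ * ∫⁻ p, K p ∂(μ.prod μ') := by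
  have hab : Measurable fun p : X × X => a p.1 * b p.2 :=
    (ha.comp measurable_fst).mul (hb.comp measurable_snd)
  have hba : Measurable fun p : X × X => b p.1 * a p.2 :=
    (hb.comp measurable_fst).mul (ha.comp measurable_snd)
  have : IsFiniteMeasure ((α : ℝ≥0∞) • l) := isFiniteMeasure_of_le μ h1
  have : IsFiniteMeasure ((α' : ℝ≥0∞) • l) := isFiniteMeasure_of_le μ' h1'
  set M := μ.prod μ' with hM
  set m := ((α : ℝ≥0∞) • l).prod ((α' : ℝ≥0∞) • l) with hm
  have hmM : m ≤ M := Measure.prod_mono h1 h1'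
  have hc1 : c ≤ 1 := by
    by_contra! hlt
    have h3 : 1 < c * c := by
      calc (1 : ℝ≥0∞) < c := hlt
        _ = c * 1 := (mul_one c).symm
        _ ≤ c * c := by gcongr
    exact absurd (hρ ▸ (le_add_self : c * c ≤ ρ + c * c)) (not_le.2 h3)
  have hctop : c ≠ ∞ := (hc1.trans_lt ENNReal.one_lt_top).ne
  have hcM : (c * c) • M ≤ m := by
    have : (c • μ).prod (c • μ') ≤ m := by
      have : IsFiniteMeasure (c • μ') := isFiniteMeasure_of_le _ h2'
      exact Measure.prod_mono h2 h2'
    rwa [Measure.prod_smul_left, Measure.prod_smul_right, smul_smul] at this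
  -- `D` is the slack in `hle`. Under `m` the two cross terms have equal finite integrals, so the
  -- slack there is all of `∫ K dm ≥ c² ∫ K dM`. As `m ≤ M`, at least this much slack is present
  -- under `M`, which leaves `(1 - c²) ∫ K dM`. The identities are kept additive to avoid truncated
  -- subtraction.
  set D : X × X → ℝ≥0∞ := fun p => (b p.1 * a p.2 + K p) - a p.1 * b p.2 with hD
  have hsplit : ∀ N : Measure (X × X), N ≤ M →
      ∫⁻ p, D p ∂N + ∫⁻ p, a p.1 * b p.2 ∂N =
        ∫⁻ p, b p.1 * a p.2 ∂N + ∫⁻ p, K p ∂N := by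
    intro N hN
    rw [← lintegral_add_right _ hab, ← lintegral_add_right _ hK]
    refine lintegral_congr_ae ?_
    filter_upwards [(Measure.absolutelyContinuous_of_le hN).ae_le hle] with p hp
    exact tsub_add_cancel_of_le hp
  have eM := hsplit M le_rfl
  have em := hsplit m hmM
  have e1 : ∫⁻ p, a p.1 * b p.2 ∂m = ∫⁻ p, b p.1 * a p.2 ∂m := by
    rw [hm, lintegral_prod_mul ha.aemeasurable hb.aemeasurable,
      lintegral_prod_mul hb.aemeasurable ha.aemeasurable]
    simp only [lintegral_smul_measure, smul_eq_mul]
    ring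
  have e2 : ∫⁻ p, b p.1 * a p.2 ∂m ≠ ∞ := by
    rw [hm, lintegral_prod_mul hb.aemeasurable ha.aemeasurable]
    simp only [lintegral_smul_measure, smul_eq_mul]
    exact ENNReal.mul_ne_top (ENNReal.mul_ne_top ENNReal.coe_ne_top hbf)
      (ENNReal.mul_ne_top ENNReal.coe_ne_top haf)
  have e3 : ∫⁻ p, D p ∂m = ∫⁻ p, K p ∂m := by
    rw [e1, add_comm] at em
    exact (ENNReal.add_right_inj e2).1 em
  have e4 : c * c * ∫⁻ p, K p ∂M ≤ ∫⁻ p, D p ∂M := by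
    calc c * c * ∫⁻ p, K p ∂M = ∫⁻ p, K p ∂((c * c) • M) := by
          rw [lintegral_smul_measure, smul_eq_mul]
      _ ≤ ∫⁻ p, K p ∂m := lintegral_mono' hcM le_rfl
      _ = ∫⁻ p, D p ∂m := e3.symm
      _ ≤ _ := lintegral_mono' hmM le_rfl
  have hfin : c * c * ∫⁻ p, K p ∂M ≠ ∞ := ENNReal.mul_ne_top (ENNReal.mul_ne_top hctop hctop) hKf
  refine (ENNReal.add_le_add_iff_right hfin).1 ?_
  calc ∫⁻ p, a p.1 * b p.2 ∂M + c * c * ∫⁻ p, K p ∂M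
      ≤ ∫⁻ p, a p.1 * b p.2 ∂M + ∫⁻ p, D p ∂M := by gcongr
    _ = ∫⁻ p, b p.1 * a p.2 ∂M + (ρ + c * c) * ∫⁻ p, K p ∂M := by
        rw [add_comm, eM, hρ, one_mul]
    _ = _ := by rw [add_mul]; ring

/-- For arrival points in `C × C` the factor `ρ` comes from the comparison with `l`. For the other
arrival points it is already present in `hout`. Together the whole symmetric term gains `ρ`, while
`H` is kept as it is. -/
lemma lintegral_cross_le_of_comparable {μ μ' l : Measure X} [IsFiniteMeasure μ]
    [IsFiniteMeasure μ'] [IsFiniteMeasure l] {C : Set X} (hC : MeasurableSet C)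
    {α α' : ℝ≥0} {c ρ : ℝ≥0∞} (hρ : ρ + c * c = 1)
    (h1 : (α : ℝ≥0∞) • l ≤ μ.restrict C) (h2 : c • μ.restrict C ≤ (α : ℝ≥0∞) • l)
    (h1' : (α' : ℝ≥0∞) • l ≤ μ'.restrict C) (h2' : c • μ'.restrict C ≤ (α' : ℝ≥0∞) • l)
    {a b : X → ℝ≥0∞} (ha : Measurable a) (hb : Measurable b) {B : ℝ≥0}
    (haB : ∀ x, a x ≤ B) (hbB : ∀ x, b x ≤ B) {θ H : ℝ≥0∞} (hθ : θ ≠ ∞) (hH : H ≠ ∞)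
    (hin : ∀ x x', a x * b x' ≤ b x * a x' + θ * (a x * b x' + b x * a x') + H)
    (hout : ∀ x x', ¬(x ∈ C ∧ x' ∈ C) →
      a x * b x' ≤ b x * a x' + ρ * θ * (a x * b x' + b x * a x') + H) :
    (∫⁻ x, a x ∂μ) * ∫⁻ x, b x ∂μ' ≤ (∫⁻ x, b x ∂μ) * (∫⁻ x, a x ∂μ') +
      ρ * θ * ((∫⁻ x, a x ∂μ) * (∫⁻ x, b x ∂μ') + (∫⁻ x, b x ∂μ) * ∫⁻ x, a x ∂μ') +
      H * (μ Set.univ * μ' Set.univ) := by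
  have hab : Measurable fun p : X × X => a p.1 * b p.2 :=
    (ha.comp measurable_fst).mul (hb.comp measurable_snd)
  have hba : Measurable fun p : X × X => b p.1 * a p.2 :=
    (hb.comp measurable_fst).mul (ha.comp measurable_snd)
  have hG : Measurable fun p : X × X => a p.1 * b p.2 + b p.1 * a p.2 := hab.add hba
  have hρ1 : ρ ≤ 1 := hρ ▸ le_self_add
  have hlt : ∀ f : X → ℝ≥0∞, (∀ x, f x ≤ B) → ∀ ν : Measure X, IsFiniteMeasure ν →
      ∫⁻ x, f x ∂ν ≠ ∞ := fun f hf ν _ =>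
    ((lintegral_mono hf).trans_lt (by
      rw [lintegral_const]
      exact ENNReal.mul_lt_top ENNReal.coe_lt_top (measure_lt_top ν _))).ne
  set K : X × X → ℝ≥0∞ := fun p => θ * (a p.1 * b p.2 + b p.1 * a p.2) + H with hKdef
  have hK : Measurable K := (hG.const_mul θ).add_const H
  set R : Set (X × X) := C ×ˢ C with hR
  have hRm : MeasurableSet R := hC.prod hC
  have hres : (μ.prod μ').restrict R = (μ.restrict C).prod (μ'.restrict C) :=
    (Measure.prod_restrict C C).symm
  have hKf : ∫⁻ p, K p ∂((μ.restrict C).prod (μ'.restrict C)) ≠ ∞ := by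
    rw [hKdef, lintegral_add_right _ measurable_const, lintegral_const_mul _ hG,
      lintegral_add_left hab, lintegral_prod_mul ha.aemeasurable hb.aemeasurable,
      lintegral_prod_mul hb.aemeasurable ha.aemeasurable, lintegral_const]
    exact ENNReal.add_ne_top.2 ⟨ENNReal.mul_ne_top hθ (ENNReal.add_ne_top.2
      ⟨ENNReal.mul_ne_top (hlt a haB _ inferInstance) (hlt b hbB _ inferInstance),
       ENNReal.mul_ne_top (hlt b hbB _ inferInstance) (hlt a haB _ inferInstance)⟩),
      ENNReal.mul_ne_top hH (measure_ne_top _ _)⟩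
  have hI := lintegral_cross_contract hρ h1 h2 h1' h2' ha hb (hlt a haB l inferInstance)
    (hlt b hbB l inferInstance) hK hKf
    (Filter.Eventually.of_forall fun p => (hin p.1 p.2).trans_eq (add_assoc _ _ _))
  rw [← hres] at hI
  have hO : ∫⁻ p in Rᶜ, a p.1 * b p.2 ∂(μ.prod μ') ≤
      ∫⁻ p in Rᶜ, b p.1 * a p.2 ∂(μ.prod μ') + ∫⁻ p in Rᶜ,
        (ρ * θ * (a p.1 * b p.2 + b p.1 * a p.2) + H) ∂(μ.prod μ') := by
    rw [← lintegral_add_left hba]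
    refine setLIntegral_mono (hba.add ((hG.const_mul _).add_const H)) fun p hp => ?_
    exact (hout p.1 p.2 hp).trans_eq (add_assoc _ _ _)
  have hI2 : ρ * ∫⁻ p in R, K p ∂(μ.prod μ') ≤
      ∫⁻ p in R, (ρ * θ * (a p.1 * b p.2 + b p.1 * a p.2) + H) ∂(μ.prod μ') := by
    rw [← lintegral_const_mul _ hK]
    refine lintegral_mono fun p => ?_
    simp only [hKdef]
    rw [mul_add, mul_assoc ρ θ]
    gcongr
    exact mul_le_of_le_one_left zero_le hρ1
  have key : ∫⁻ p, a p.1 * b p.2 ∂(μ.prod μ') ≤ ∫⁻ p, b p.1 * a p.2 ∂(μ.prod μ') +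
      ∫⁻ p, (ρ * θ * (a p.1 * b p.2 + b p.1 * a p.2) + H) ∂(μ.prod μ') := by
    rw [← lintegral_add_compl (fun p => a p.1 * b p.2) hRm,
      ← lintegral_add_compl (fun p => b p.1 * a p.2) hRm,
      ← lintegral_add_compl (fun p => ρ * θ * (a p.1 * b p.2 + b p.1 * a p.2) + H) hRm]
    calc _ ≤ _ := add_le_add (hI.trans (add_le_add_right hI2 _)) hO
      _ = _ := by ring
  rw [lintegral_add_right _ measurable_const, lintegral_const_mul _ hG,
    lintegral_add_left hab, lintegral_const,
    lintegral_prod_mul ha.aemeasurable hb.aemeasurable,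
    lintegral_prod_mul hb.aemeasurable ha.aemeasurable, ← Set.univ_prod_univ,
    Measure.prod_prod, ← add_assoc] at key
  exact key

/-- A quantitative bound for the antisymmetric kernel `a(x) b(x') - b(x) a(x')`: for every `t`, it
is at most `ρ ^ (p - 2t)` times its symmetric counterpart, up to the error `η ^ t * s`. If `good`
holds, one power of `ρ` is gained at the pairs outside `C × C`. -/
structure Mixes (C : Set X) (ρ η : ℝ≥0∞) (good : Prop) (p : ℕ) (s : ℝ≥0∞) (a b : X → ℝ≥0∞) :
    Prop where
  measurable_left : Measurable a
  measurable_right : Measurable b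
  bounded : ∃ B : ℝ≥0, (∀ x, a x ≤ B) ∧ ∀ x, b x ≤ B
  mul_le : ∀ x x', a x * b x' ≤ s
  mix : ∀ t x x', a x * b x' ≤
    b x * a x' + ρ ^ (p - 2 * t) * (a x * b x' + b x * a x') + η ^ t * s
  mix_out : good → ∀ t x x', ¬(x ∈ C ∧ x' ∈ C) → a x * b x' ≤
    b x * a x' + ρ ^ (p + 1 - 2 * t) * (a x * b x' + b x * a x') + η ^ t * s

/-- With `p = 0` the exponent is zero for every `t` and the symmetric term alone suffices. No kernel
has acted yet, so no gain off `C × C` is available, hence `False`. -/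
lemma Mixes.of_mul_le {C : Set X} {ρ η s : ℝ≥0∞} {a b : X → ℝ≥0∞} (ha : Measurable a)
    (hb : Measurable b) (hB : ∃ B : ℝ≥0, (∀ x, a x ≤ B) ∧ ∀ x, b x ≤ B)
    (hs : ∀ x x', a x * b x' ≤ s) : Mixes C ρ η False 0 s a b where
  measurable_left := ha
  measurable_right := hb
  bounded := hB
  mul_le := hs
  mix t x x' := by
    simp only [Nat.zero_sub, pow_zero, one_mul]
    exact le_add_right (le_add_left le_self_add)
  mix_out h := h.elim

/-- A kernel `L` of total mass at most `σ` that satisfies a Doeblin condition on `C`, with ratio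
`c`, and has mass at most `η σ` off `C`. -/
structure DoeblinOn (C : Set X) (c η σ : ℝ≥0∞) (L : Kernel X X) : Prop where
  comparable : ∃ l : Measure X, IsFiniteMeasure l ∧ ∀ x ∈ C, ∃ α : ℝ≥0,
    (α : ℝ≥0∞) • l ≤ (L x).restrict C ∧ c • (L x).restrict C ≤ (α : ℝ≥0∞) • l
  off : ∀ x ∉ C, L x Set.univ ≤ η * σ

/-- The mixing bound passes through one kernel. -/
lemma Mixes.lintegral_kernel {C : Set X} (hC : MeasurableSet C) {c ρ η s σ : ℝ≥0∞}
    (hρ : ρ + c * c = 1) (hη : η ≠ ∞) (hs : s ≠ ∞) (hσ : σ ≠ ∞) {good good' : Prop} {p p' : ℕ}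
    {a b : X → ℝ≥0∞} (h : Mixes C ρ η good p s a b) {L : Kernel X X}
    (hL : ∀ x, L x Set.univ ≤ σ) (hD : good' → DoeblinOn C c η σ L)
    (hp : p' ≤ p + 1) (hp' : ¬(good ∧ good') → p' ≤ p) :
    Mixes C ρ η good' p' (σ * σ * s) (fun x => ∫⁻ x', a x' ∂L x) (fun x => ∫⁻ x', b x' ∂L x) := by
  have hρ1 : ρ ≤ 1 := hρ ▸ le_self_add
  have hfin : ∀ x, IsFiniteMeasure (L x) := fun x => ⟨(hL x).trans_lt hσ.lt_top⟩
  have hle : ∀ x x', (∫⁻ x', a x' ∂L x) * ∫⁻ x', b x' ∂L x' ≤ σ * σ * s := by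
    intro x x'
    rw [← lintegral_prod_mul h.measurable_left.aemeasurable h.measurable_right.aemeasurable]
    calc _ ≤ ∫⁻ _, s ∂((L x).prod (L x')) := lintegral_mono fun p => h.mul_le p.1 p.2
      _ = s * (L x Set.univ * L x' Set.univ) := by
          rw [lintegral_const, ← Set.univ_prod_univ, Measure.prod_prod]
      _ ≤ s * (σ * σ) := by gcongr <;> exact hL _
      _ = _ := mul_comm _ _
  -- Off `C × C` one of the two masses carries a factor `η`, so the old bound at `u` serves for `u +
  -- 1`. The exponent must allow both for the step from `p` to `p'` and for the extra power claimed
  -- off `C × C`. This is why `t` has weight two. At `t = 0` the error term is already the trivial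
  -- bound.
  have hout : good' → ∀ t x x', ¬(x ∈ C ∧ x' ∈ C) →
      (∫⁻ x', a x' ∂L x) * ∫⁻ x', b x' ∂L x' ≤ (∫⁻ x', b x' ∂L x) * (∫⁻ x', a x' ∂L x') +
      ρ ^ (p' + 1 - 2 * t) * ((∫⁻ x', a x' ∂L x) * (∫⁻ x', b x' ∂L x') +
        (∫⁻ x', b x' ∂L x) * ∫⁻ x', a x' ∂L x') + η ^ t * (σ * σ * s) := by
    intro hg t x x' hx
    cases t with
    | zero => rw [pow_zero, one_mul]; exact (hle x x').trans le_add_self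
    | succ u =>
      refine (lintegral_cross_le (μ := L x) (μ' := L x') h.measurable_left h.measurable_right
        (h.mix u)).trans ?_
      have hm : L x Set.univ * L x' Set.univ ≤ η * σ * σ := by
        by_cases hxC : x ∈ C
        · have hx' : x' ∉ C := fun h' => hx ⟨hxC, h'⟩
          calc _ ≤ σ * (η * σ) := mul_le_mul' (hL x) ((hD hg).off x' hx')
            _ = _ := by ring
        · exact mul_le_mul' ((hD hg).off x hxC) (hL x')
      have hpow : ρ ^ (p - 2 * u) ≤ ρ ^ (p' + 1 - 2 * (u + 1)) :=
        pow_le_pow_right_of_le_one' hρ1 (by omega)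
      have : η ^ u * s * (L x Set.univ * L x' Set.univ) ≤ η ^ (u + 1) * (σ * σ * s) := by
        calc _ ≤ η ^ u * s * (η * σ * σ) := by gcongr
          _ = _ := by ring
      gcongr
  -- No gain is needed here: either `p` has not grown, or `p' ≤ p + 1 ≤ 2t` and both truncated
  -- exponents vanish.
  have hint : ∀ t x x', (p' ≤ p ∨ p < 2 * t) →
      (∫⁻ x', a x' ∂L x) * ∫⁻ x', b x' ∂L x' ≤ (∫⁻ x', b x' ∂L x) * (∫⁻ x', a x' ∂L x') +
      ρ ^ (p' - 2 * t) * ((∫⁻ x', a x' ∂L x) * (∫⁻ x', b x' ∂L x') +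
        (∫⁻ x', b x' ∂L x) * ∫⁻ x', a x' ∂L x') + η ^ t * (σ * σ * s) := by
    intro t x x' hpt
    refine (lintegral_cross_le (μ := L x) (μ' := L x') h.measurable_left h.measurable_right
      (h.mix t)).trans ?_
    have hpow : ρ ^ (p - 2 * t) ≤ ρ ^ (p' - 2 * t) :=
      pow_le_pow_right_of_le_one' hρ1 (by omega)
    have : η ^ t * s * (L x Set.univ * L x' Set.univ) ≤ η ^ t * (σ * σ * s) := by
      calc _ ≤ η ^ t * s * (σ * σ) := by gcongr <;> exact hL _
        _ = _ := by ring
    gcongr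
  refine ⟨h.measurable_left.lintegral_kernel, h.measurable_right.lintegral_kernel, ?_, hle, ?_,
    hout⟩
  · obtain ⟨B, hB1, hB2⟩ := h.bounded
    lift σ to ℝ≥0 using hσ
    have : ∀ f : X → ℝ≥0∞, (∀ x, f x ≤ B) → ∀ x, ∫⁻ x', f x' ∂L x ≤ (B * σ : ℝ≥0) := by
      intro f hf x
      calc ∫⁻ x', f x' ∂L x ≤ ∫⁻ _, (B : ℝ≥0∞) ∂L x := lintegral_mono hf
        _ = B * L x Set.univ := lintegral_const _
        _ ≤ B * σ := by gcongr; exact hL x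
        _ = _ := by push_cast; rfl
    exact ⟨B * σ, this a hB1, this b hB2⟩
  · intro t x x'
    -- A gain needs both properties. `good'` makes the present kernel Doeblin from `C × C`, and
    -- `good`, which concerns the following block in time, treats arrival points outside `C × C`.
    by_cases hgg : good ∧ good'
    · by_cases hx : x ∈ C ∧ x' ∈ C
      · rcases le_or_gt (2 * t) p with htp | htp
        · obtain ⟨l, hl, hcomp⟩ := (hD hgg.2).comparable
          obtain ⟨α, h1, h2⟩ := hcomp x hx.1
          obtain ⟨α', h1', h2'⟩ := hcomp x' hx.2
          obtain ⟨B, hB1, hB2⟩ := h.bounded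
          have hpe : ρ ^ (p + 1 - 2 * t) = ρ * ρ ^ (p - 2 * t) := by
            rw [← pow_succ', show p + 1 - 2 * t = p - 2 * t + 1 by omega]
          have hρtop : ρ ≠ ∞ := (hρ1.trans_lt ENNReal.one_lt_top).ne
          have hmo := h.mix_out hgg.1 t
          rw [hpe] at hmo
          refine (lintegral_cross_le_of_comparable hC hρ h1 h2 h1' h2' h.measurable_left
            h.measurable_right hB1 hB2 (ENNReal.pow_ne_top hρtop)
            (ENNReal.mul_ne_top (ENNReal.pow_ne_top hη) hs) (h.mix t) hmo).trans ?_
          have hpow : ρ * ρ ^ (p - 2 * t) ≤ ρ ^ (p' - 2 * t) := by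
            rw [← hpe]
            exact pow_le_pow_right_of_le_one' hρ1 (by omega)
          have : η ^ t * s * (L x Set.univ * L x' Set.univ) ≤ η ^ t * (σ * σ * s) := by
            calc _ ≤ η ^ t * s * (σ * σ) := by gcongr <;> exact hL _
              _ = _ := by ring
          gcongr
        · exact hint t x x' (Or.inr htp)
      · refine (hout hgg.2 t x x' hx).trans ?_
        have hpow : ρ ^ (p' + 1 - 2 * t) ≤ ρ ^ (p' - 2 * t) :=
          pow_le_pow_right_of_le_one' hρ1 (by omega)
        gcongr
    · exact hint t x x' (Or.inl (hp' hgg))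

end Contraction

/-! ### Bad blocks and mixing along windows -/

open Classical in
/-- The number of blocks `y_{(i+l)r}, …, y_{(i+l+1)r-1}`, `0 ≤ l < N`, that are not in `K`. -/
noncomputable def badCount {E : Type*} {r : ℕ} (K : Set (Fin r → E)) (y : ℤ → E) (i : ℤ) (N : ℕ) :
    ℕ :=
  ∑ l ∈ Finset.range N, if block y ((i + l) * r) r ∈ K then 0 else 1

open Classical in
lemma badCount_succ {E : Type*} {r : ℕ} (K : Set (Fin r → E)) (y : ℤ → E) (i : ℤ) (N : ℕ) :
    badCount K y i (N + 1) = badCount K y (i + 1) N + if block y (i * r) r ∈ K then 0 else 1 := by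
  rw [badCount, Finset.sum_range_succ']
  simp only [badCount, Nat.cast_zero, add_zero]
  congr 1
  refine Finset.sum_congr rfl fun l _ => ?_
  push_cast
  rw [show i + ((l : ℤ) + 1) = i + 1 + l by ring]

namespace HMM

variable {X S : Type*} [MeasurableSpace X] [MeasurableSpace S] {M : HMM X S} {r : ℕ}
  {C : Set X} {εm εp : (Fin r → S) → ℝ≥0} {lam : (Fin r → S) → ProbabilityMeasure X}
  {φ : (Fin r → S) → X → ℝ≥0} {c η : ℝ≥0∞}

/-- The common measure is `λ⟨z⟩` and the multiplier at `x` is `ε⁻ φ(x)`, since `c ε⁺ ≤ ε⁻`.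
Replacing the supremum by a larger `σ` allows majorants to be used throughout. -/
lemma IsLocalDoeblin.doeblinOn (h : M.IsLocalDoeblin r C εm εp lam φ) {z : Fin r → S}
    (hc : c ≤ (εm z : ℝ≥0∞) / εp z) {σ : ℝ≥0∞} (hσ : M.supLkh z ≤ σ)
    (hη : (⨆ x ∈ Cᶜ, M.lkh z x Set.univ) ≤ η * M.supLkh z) : DoeblinOn C c η σ (M.lkh z) where
  comparable := by
    refine ⟨lam z, inferInstance, fun x hx => ⟨εm z * φ z x, ?_, ?_⟩⟩
    · refine Measure.le_iff.2 fun A hA => ?_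
      rw [Measure.smul_apply, Measure.restrict_apply hA, smul_eq_mul, ENNReal.coe_mul]
      exact h.lower z x hx A hA
    · refine Measure.le_iff.2 fun A hA => ?_
      rw [Measure.smul_apply, Measure.smul_apply, Measure.restrict_apply hA, smul_eq_mul,
        smul_eq_mul, ENNReal.coe_mul]
      have hp : (εp z : ℝ≥0∞) ≠ 0 := by simpa using (h.εp_pos z).ne'
      have hce : c * εp z ≤ εm z := by
        rwa [ENNReal.le_div_iff_mul_le (Or.inl hp) (Or.inl ENNReal.coe_ne_top)] at hc
      calc c * M.lkh z x (A ∩ C) ≤ c * (εp z * φ z x * (lam z : Measure X) A) := by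
            gcongr; exact h.upper z x hx A hA
        _ = c * εp z * (φ z x * (lam z : Measure X) A) := by ring
        _ ≤ εm z * (φ z x * (lam z : Measure X) A) := by gcongr
        _ = _ := by ring
  off x hx := by
    calc M.lkh z x Set.univ ≤ ⨆ x ∈ Cᶜ, M.lkh z x Set.univ :=
          le_iSup₂ (f := fun x (_ : x ∈ Cᶜ) => M.lkh z x Set.univ) x hx
      _ ≤ η * M.supLkh z := hη
      _ ≤ η * σ := by gcongr

variable {K : Set (Fin r → S)} {ρ s : ℝ≥0∞} {y : ℤ → S} {a b : X → ℝ≥0∞}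

open Classical in
/-- Mixing along `N` consecutive aligned blocks. -/
lemma mixes_blocks (h : M.IsLocalDoeblin r C εm εp lam φ)
    (hc : ∀ z ∈ K, c ≤ (εm z : ℝ≥0∞) / εp z)
    (hη : ∀ z ∈ K, (⨆ x ∈ Cᶜ, M.lkh z x Set.univ) ≤ η * M.supLkh z)
    (hρ : ρ + c * c = 1) (hηtop : η ≠ ∞) (hs : s ≠ ∞) (hy : ∀ j n, M.majorant y j n ≠ ∞)
    (N : ℕ) (i : ℤ)
    (hab : Mixes C ρ η False 0 s (M.act y ((i + N) * r) 0 a) (M.act y ((i + N) * r) 0 b)) :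
    Mixes C ρ η (0 < N ∧ block y (i * r) r ∈ K)
      (N - (2 * badCount K y i N + if 0 < N ∧ block y (i * r) r ∈ K then 1 else 0))
      (M.majorant y (i * r) (N * r) * M.majorant y (i * r) (N * r) * s)
      (M.act y (i * r) (N * r) (M.act y ((i + N) * r) 0 a))
      (M.act y (i * r) (N * r) (M.act y ((i + N) * r) 0 b)) := by
  have ha := hab.measurable_left
  have hb := hab.measurable_right
  -- A power of `ρ` is lost at each bad block and at each block whose successor is bad, which makes
  -- at most two losses per bad block, and also at the last block, which has no successor. If the
  -- first block is bad, it has no predecessor to spoil and this saves one loss. The indicator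
  -- therefore counts only when the first block is good.
  induction N generalizing i with
  | zero =>
    rw [zero_mul, act_zero _ _ _ ha, act_zero _ _ _ hb]
    simpa [majorant] using hab
  | succ N ih =>
    have e0 : i + ((N + 1 : ℕ) : ℤ) = i + 1 + N := by push_cast; ring
    rw [e0] at hab ha hb ⊢
    have h1 := ih (i + 1) hab ha hb
    have e1 : (N + 1) * r = r + N * r := by ring
    have e2 : (i + 1) * (r : ℤ) = i * r + r := by ring
    rw [e2] at h1
    rw [e1, act_add _ _ _ _ _ ha, act_add _ _ _ _ _ hb, majorant_add]
    have h2 := h1.lintegral_kernel (p' := N + 1 - (2 * badCount K y i (N + 1) +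
        if 0 < N + 1 ∧ block y (i * r) r ∈ K then 1 else 0))
      (good' := 0 < N + 1 ∧ block y (i * r) r ∈ K) h.measurableSet hρ hηtop
      (ENNReal.mul_ne_top (ENNReal.mul_ne_top (hy _ _) (hy _ _)) hs) (hy (i * r) r)
      (M.lkh_univ_le y (i * r) r)
      (fun hg => h.doeblinOn (hc _ hg.2) (M.supLkh_le_majorant y _ _) (hη _ hg.2)) ?_ ?_
    · convert h2 using 1
      · ring
      · rfl
      · rfl
    · rw [badCount_succ]
      by_cases h3 : block y (i * r) r ∈ K <;>
        simp only [h3, and_false, if_false, if_true, Nat.succ_pos, and_true] <;>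
        split_ifs <;> omega
    · rw [badCount_succ]
      intro hn
      by_cases h3 : block y (i * r) r ∈ K
      · by_cases h4 : 0 < N ∧ block y (i * r + r) r ∈ K
        · exact absurd ⟨h4, Nat.succ_pos N, h3⟩ hn
        · simp only [h3, h4, if_true, if_false, Nat.succ_pos, and_true]
          omega
      · simp only [h3, and_false, if_false]
        split_ifs <;> omega

/-- Mixing along the window `[-m, k)`. -/
theorem mixes_window (h : M.IsLocalDoeblin r C εm εp lam φ)
    (hc : ∀ z ∈ K, c ≤ (εm z : ℝ≥0∞) / εp z)
    (hη : ∀ z ∈ K, (⨆ x ∈ Cᶜ, M.lkh z x Set.univ) ≤ η * M.supLkh z)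
    (hρ : ρ + c * c = 1) (hηtop : η ≠ ∞) (hs : s ≠ ∞) (hy : ∀ j n, M.majorant y j n ≠ ∞)
    (ha : Measurable a) (hb : Measurable b) (hB : ∃ B : ℝ≥0, (∀ x, a x ≤ B) ∧ ∀ x, b x ≤ B)
    (hab : ∀ x x', a x * b x' ≤ s) (m k : ℕ) :
    Mixes C ρ η False (m / r + k / r - (2 * badCount K y (-(m / r : ℕ)) (m / r + k / r) + 1))
      (M.majorant y (-m) (m + k) * M.majorant y (-m) (m + k) * s)
      (M.act y (-m) (m + k) a) (M.act y (-m) (m + k) b) := by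
  classical
  obtain ⟨p, hp⟩ : ∃ p, p = m / r := ⟨_, rfl⟩
  obtain ⟨q, hq⟩ : ∃ q, q = k / r := ⟨_, rfl⟩
  rw [← hp, ← hq]
  have hm : m = m % r + p * r := by rw [hp, mul_comm]; exact (Nat.mod_add_div m r).symm
  have hk : k = q * r + k % r := by rw [hq, mul_comm]; exact (Nat.div_add_mod k r).symm
  set l := m % r
  set e := k % r
  -- The window is a left remainder, `p + q` aligned blocks and a right remainder. The remainders
  -- are crossed without gain, at the price of their majorants. The `+ 1` in the exponent dominates
  -- the indicator from the aligned part.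
  have h0 : Mixes C ρ η False 0 s a b := Mixes.of_mul_le ha hb hB hab
  have h1 := h0.lintegral_kernel (p' := 0) (good' := False) (L := M.lkh (block y (q * r) e))
    h.measurableSet hρ hηtop hs (hy (q * r) e) (M.lkh_univ_le y (q * r) e) False.elim
    (by omega) (fun _ => le_rfl)
  change Mixes C ρ η False 0 _ (M.act y (q * r) e a) (M.act y (q * r) e b) at h1
  have hma := h1.measurable_left
  have hmb := h1.measurable_right
  have hs1 : M.majorant y (q * r) e * M.majorant y (q * r) e * s ≠ ∞ :=
    ENNReal.mul_ne_top (ENNReal.mul_ne_top (hy _ _) (hy _ _)) hs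
  have h2 := mixes_blocks (a := M.act y (q * r) e a) (b := M.act y (q * r) e b) h hc hη hρ hηtop
    hs1 hy (p + q) (-(p : ℤ)) (by rwa [act_zero _ _ _ hma, act_zero _ _ _ hmb])
  rw [act_zero _ _ _ hma, act_zero _ _ _ hmb] at h2
  have h3 := h2.lintegral_kernel (p' := p + q - (2 * badCount K y (-(p : ℤ)) (p + q) + 1))
    (good' := False) (L := M.lkh (block y (-m) l))
    h.measurableSet hρ hηtop (ENNReal.mul_ne_top (ENNReal.mul_ne_top (hy _ _) (hy _ _)) hs1)
    (hy (-m) l) (M.lkh_univ_le y (-m) l) False.elim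
    (by split_ifs <;> omega) (fun _ => by split_ifs <;> omega)
  have e1 : m + k = l + ((p + q) * r + e) := by
    conv_lhs => rw [hm, hk]
    ring
  have e2 : -(m : ℤ) + l = -(p : ℤ) * r := by
    have : (m : ℤ) = l + p * r := by exact_mod_cast hm
    rw [this]; ring
  have e3 : -(p : ℤ) * r + ((p + q) * r : ℕ) = q * r := by push_cast; ring
  rw [e1, act_add _ _ _ _ _ ha, act_add _ _ _ _ _ hb, act_add _ _ _ _ _ ha,
    act_add _ _ _ _ _ hb, majorant_add, majorant_add, e2, e3]
  convert h3 using 1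
  · ring
  · rfl
  · rfl

/-- The mixing bound, integrated against two finite measures. -/
lemma _root_.Mixes.lintegral_le {p : ℕ} (h : Mixes C ρ η False p s a b) (μ μ' : Measure X)
    [IsFiniteMeasure μ] [IsFiniteMeasure μ'] (t : ℕ) :
    (∫⁻ x, a x ∂μ) * ∫⁻ x, b x ∂μ' ≤ (∫⁻ x, b x ∂μ) * (∫⁻ x, a x ∂μ') +
      ρ ^ (p - 2 * t) * ((∫⁻ x, a x ∂μ) * (∫⁻ x, b x ∂μ') + (∫⁻ x, b x ∂μ) * ∫⁻ x, a x ∂μ') +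
      η ^ t * s * (μ Set.univ * μ' Set.univ) :=
  lintegral_cross_le h.measurable_left h.measurable_right (h.mix t)

end HMM

/-! ### Exponentials and logarithms on the extended half-line -/

/-- The exponential of a real number, as an element of `[0, ∞]`. -/
noncomputable def expE (x : ℝ) : ℝ≥0∞ := ENNReal.ofReal (Real.exp x)

lemma expE_add (x y : ℝ) : expE (x + y) = expE x * expE y := by
  rw [expE, Real.exp_add, ENNReal.ofReal_mul (Real.exp_pos x).le]; rfl

lemma expE_mono {x y : ℝ} (h : x ≤ y) : expE x ≤ expE y :=
  ENNReal.ofReal_le_ofReal (Real.exp_le_exp.2 h)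

lemma expE_ne_top (x : ℝ) : expE x ≠ ∞ := ENNReal.ofReal_ne_top

lemma expE_pos (x : ℝ) : 0 < expE x := ENNReal.ofReal_pos.2 (Real.exp_pos x)

lemma expE_zero : expE 0 = 1 := by simp [expE]

lemma toReal_expE (x : ℝ) : (expE x).toReal = Real.exp x :=
  ENNReal.toReal_ofReal (Real.exp_pos x).le

lemma expE_sum {ι : Type*} (s : Finset ι) (f : ι → ℝ) :
    expE (∑ i ∈ s, f i) = ∏ i ∈ s, expE (f i) := by
  rw [expE, Real.exp_sum, ENNReal.ofReal_prod_of_nonneg fun i _ => (Real.exp_pos _).le]; rfl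

lemma expE_pow (x : ℝ) (n : ℕ) : expE x ^ n = expE (n * x) := by
  rw [expE, expE, ← ENNReal.ofReal_pow (Real.exp_pos x).le, ← Real.exp_nat_mul]

lemma le_of_expE_mul_le {x y : ℝ} {a b : ℝ≥0∞} (h : expE x ≤ a * b) (hb : b ≤ expE y) :
    expE (x - y) ≤ a := by
  have h1 : expE (x - y) * expE y ≤ a * expE y := by
    rw [← expE_add, sub_add_cancel]
    exact h.trans (by gcongr)
  exact (ENNReal.mul_le_mul_iff_left (expE_pos y).ne' (expE_ne_top y)).1 h1

lemma le_expE_logPlus {x : ℝ≥0∞} (h : logPlus x < ∞) : x ≤ expE (logPlus x).toReal := by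
  have hx : x ≠ ∞ := by
    rintro rfl; simp [logPlus] at h
  rcases eq_or_ne x 0 with rfl | h0
  · exact zero_le
  have hpos := ENNReal.toReal_pos h0 hx
  rw [logPlus, ENNReal.log_pos_real h0 hx, EReal.toENNReal_of_ne_top (EReal.coe_ne_top _),
    EReal.toReal_coe, expE, ← ENNReal.ofReal_toReal hx, ENNReal.toReal_ofReal_eq_iff.2 hpos.le]
  refine ENNReal.ofReal_le_ofReal ?_
  rw [ENNReal.toReal_ofReal']
  calc x.toReal = Real.exp (Real.log x.toReal) := (Real.exp_log hpos).symm
    _ ≤ _ := Real.exp_le_exp.2 (le_max_left _ _)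

lemma expE_neg_logMinus_le {x : ℝ≥0∞} (h : logMinus x < ∞) :
    expE (-(logMinus x).toReal) ≤ x := by
  have h0 : x ≠ 0 := by
    rintro rfl; simp [logMinus] at h
  rcases eq_or_ne x ∞ with rfl | hx
  · exact le_top
  have hpos := ENNReal.toReal_pos h0 hx
  rw [logMinus, ENNReal.log_pos_real h0 hx, ← EReal.coe_neg,
    EReal.toENNReal_of_ne_top (EReal.coe_ne_top _),
    EReal.toReal_coe, expE]
  refine ENNReal.ofReal_le_of_le_toReal ?_
  rw [ENNReal.toReal_ofReal']
  calc _ ≤ Real.exp (Real.log x.toReal) := by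
        refine Real.exp_le_exp.2 ?_
        linarith [le_max_left (-Real.log x.toReal) 0]
    _ = _ := Real.exp_log hpos

lemma measurable_logMinus : Measurable logMinus :=
  ENNReal.measurable_log.neg.ereal_toENNReal

/-! ### Linear control of likelihoods along a path -/

namespace HMM

variable {X S : Type*} [MeasurableSpace X] [MeasurableSpace S] (M : HMM X S)

/-- The product of the numbers `inf_{x ∈ D} L⟨Z_i⟩(x, D)` over `N` consecutive aligned blocks. -/
noncomputable def prodInf (r : ℕ) (D : Set X) (y : ℤ → S) (i : ℤ) (N : ℕ) : ℝ≥0∞ :=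
  ∏ l ∈ Finset.range N, ⨅ x ∈ D, M.lkh (block y ((i + l) * r) r) x D

variable {r : ℕ} {D : Set X} (y : ℤ → S)

/-- Only the paths that are in `D` at each block end are kept, and the infimum over `D` makes the
successive factors independent of the state. -/
lemma prodInf_le_lkh (hD : MeasurableSet D) (N : ℕ) (i : ℤ) {x : X} (hx : x ∈ D) :
    M.prodInf r D y i N ≤ M.lkh (block y (i * r) (N * r)) x D := by
  rw [← act_indicator _ _ _ _ hD]
  have hm : Measurable (D.indicator (1 : X → ℝ≥0∞)) := measurable_one.indicator hD
  induction N generalizing i x with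
  | zero => rw [zero_mul, act_zero _ _ _ hm]; simp [prodInf, hx]
  | succ N ih =>
    have e1 : (N + 1) * r = r + N * r := by ring
    have e2 : i * r + (r : ℤ) = (i + 1) * r := by ring
    rw [e1, act_add _ _ _ _ _ hm, prodInf, Finset.prod_range_succ', e2]
    have e3 : ∏ k ∈ Finset.range N,
        ⨅ x ∈ D, M.lkh (block y ((i + ((k + 1 : ℕ) : ℤ)) * r) r) x D =
        M.prodInf r D y (i + 1) N := by
      refine Finset.prod_congr rfl fun k _ => ?_
      push_cast
      rw [show i + ((k : ℤ) + 1) = i + 1 + k by ring]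
    rw [e3, Nat.cast_zero, add_zero]
    calc M.prodInf r D y (i + 1) N * ⨅ x ∈ D, M.lkh (block y (i * r) r) x D
        ≤ M.prodInf r D y (i + 1) N * M.lkh (block y (i * r) r) x D := by
          gcongr; exact iInf₂_le x hx
      _ = M.act y (i * r) r (fun x => M.prodInf r D y (i + 1) N * D.indicator 1 x) x := by
          rw [act_const_mul _ _ _ _ _ hm, act_indicator _ _ _ _ hD]
      _ ≤ _ := act_mono _ _ _ _ (fun x' => by
          by_cases hx' : x' ∈ D
          · simpa [hx'] using ih (i + 1) hx'
          · simp [hx']) x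

/-- The chain first enters `D` at an aligned time `i r`, after `l` steps, and is then kept in `D` at
block times. These `l < r` steps are the reason for the moment conditions defining `ℳ(D, r)`. -/
lemma push_mul_prodInf_le_lik (hD : MeasurableSet D) (χ : ProbabilityMeasure X) {i j : ℤ}
    {l : ℕ} (h : j + l = i * r) (N : ℕ) :
    M.push χ (block y j l) D * M.prodInf r D y i N ≤ M.lik χ (block y j (l + N * r)) := by
  rw [lik_add, h]
  calc M.push χ (block y j l) D * M.prodInf r D y i N
      = ∫⁻ _ in D, M.prodInf r D y i N ∂M.push χ (block y j l) := by
        rw [setLIntegral_const, mul_comm]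
    _ ≤ ∫⁻ x in D, M.act y (i * r) (N * r) (fun _ => 1) x ∂M.push χ (block y j l) := by
        refine setLIntegral_mono (M.measurable_act _ _ _ measurable_const) fun x hx => ?_
        rw [act_one]
        exact (M.prodInf_le_lkh y hD N i hx).trans (measure_mono (Set.subset_univ _))
    _ ≤ _ := setLIntegral_le_lintegral _ _

/-- Used to remove padding on the right: a lower bound for the padded window gives one for the
window itself, up to the majorant of the padding. -/
lemma lik_add_le (χ : ProbabilityMeasure X) (j : ℤ) (n e : ℕ) :
    M.lik χ (block y j (n + e)) ≤ M.lik χ (block y j n) * M.majorant y (j + n) e := by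
  rw [lik_add]
  calc _ ≤ ∫⁻ _, M.majorant y (j + n) e ∂M.push χ (block y j n) :=
        lintegral_mono fun x => by rw [act_one]; exact M.lkh_univ_le y _ _ x
    _ = _ := by rw [lintegral_const, mul_comm]; rfl

/-- The analogue for padding on the left, possible because the supremum ranges over all starting
points. -/
lemma supLkh_add_le (j : ℤ) (l n : ℕ) :
    M.supLkh (block y j (l + n)) ≤ M.supLkh (block y (j + l) n) * M.majorant y j l := by
  refine iSup_le fun x => ?_
  rw [← act_one, act_add _ _ _ _ _ measurable_const, mul_comm]
  refine M.act_le y j l (M.measurable_act _ _ _ measurable_const) (fun x' => ?_) x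
  rw [act_one]
  exact le_iSup (fun x => M.lkh (block y (j + l) n) x Set.univ) x'

lemma prodInf_le_supLkh (hD : MeasurableSet D) (hne : D.Nonempty) (i : ℤ) (N : ℕ) :
    M.prodInf r D y i N ≤ M.supLkh (block y (i * r) (N * r)) := by
  obtain ⟨x, hx⟩ := hne
  exact ((M.prodInf_le_lkh y hD N i hx).trans (measure_mono (Set.subset_univ _))).trans
    (le_iSup (fun x => M.lkh (block y (i * r) (N * r)) x Set.univ) x)

/-- Linear control, with rate `c` and additive constant `C₀`, of the logarithms of the majorants
and minorants of the likelihoods and of the number of bad blocks along a path. -/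
structure PathControl (r : ℕ) (K : Set (Fin r → S)) (D : Set X) (c C₀ : ℝ) (y : ℤ → S) :
    Prop where
  nonneg : 0 ≤ C₀
  majorant_le : ∀ p q : ℕ, M.majorant y (-p) (p + q) ≤ expE (c * (p + q) + C₀)
  le_prodInf : ∀ p q : ℕ, expE (-(c * (p + q) + C₀)) ≤ M.prodInf r D y (-p) (p + q)
  badCount_le : ∀ p q : ℕ, (badCount K y (-p) (p + q) : ℝ) ≤ (p + q) / 3 + C₀

/-- Linear control of the mass that `χ` sends to `D` along the windows `[-m, -m + l)`. -/
def InitControl (r : ℕ) (D : Set X) (χ : ProbabilityMeasure X) (C₀ : ℝ) (y : ℤ → S) : Prop :=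
  ∀ l ≤ r, ∀ m : ℕ, expE (-(m + C₀)) ≤ M.push χ (block y (-m) l) D

variable {M} {K : Set (Fin r → S)} {c C₀ : ℝ} {y}

lemma PathControl.mono (h : M.PathControl r K D c C₀ y) {C₁ : ℝ} (hC : C₀ ≤ C₁) :
    M.PathControl r K D c C₁ y where
  nonneg := h.nonneg.trans hC
  majorant_le p q := (h.majorant_le p q).trans (expE_mono (by linarith))
  le_prodInf p q := (expE_mono (by linarith)).trans (h.le_prodInf p q)
  badCount_le p q := (h.badCount_le p q).trans (by linarith)

lemma InitControl.mono {χ : ProbabilityMeasure X} (h : M.InitControl r D χ C₀ y) {C₁ : ℝ}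
    (hC : C₀ ≤ C₁) : M.InitControl r D χ C₁ y := fun l hl m =>
  (expE_mono (by linarith)).trans (h l hl m)

lemma PathControl.majorant_ne_top (h : M.PathControl r K D c C₀ y) (j : ℤ) (n : ℕ) :
    M.majorant y j n ≠ ∞ := by
  refine ne_top_of_le_ne_top (expE_ne_top (c * ((j.natAbs : ℕ) + (j.natAbs + n : ℕ)) + C₀))
    ((M.majorant_le_of_le y ?_ ?_).trans (h.majorant_le j.natAbs (j.natAbs + n)))
  · omega
  · simp only [Nat.cast_add]; omega

lemma PathControl.majorant_le_expE (h : M.PathControl r K D c C₀ y) {n : ℝ}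
    (hn : C₀ ≤ n) {j : ℤ} {e p q : ℕ} (hj : -(p : ℤ) ≤ j) (he : j + e ≤ q)
    (hpq : (p : ℝ) + q ≤ 2 * n) (hc : 0 ≤ c) :
    M.majorant y j e ≤ expE (2 * (c + 1) * n) := by
  refine ((M.majorant_le_of_le y hj ?_).trans (h.majorant_le p q)).trans (expE_mono ?_)
  · push_cast; omega
  · nlinarith [mul_le_mul_of_nonneg_left hpq hc, h.nonneg]

/-- Exponential lower bound for the likelihood of the window `[-m, k)`. -/
lemma PathControl.le_lik (h : M.PathControl r K D c C₀ y) (hD : MeasurableSet D) (hr : 0 < r)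
    (hc : 0 ≤ c) {χ : ProbabilityMeasure X} (hχ : M.InitControl r D χ C₀ y) {m k : ℕ}
    (hE : 24 * r * (C₀ + 1) ≤ m + k) :
    expE (-(4 * (c + 1) * (m + k))) ≤ M.lik χ (block y (-m) (m + k)) := by
  have hr1 : (1 : ℝ) ≤ r := by exact_mod_cast hr
  have h0 := h.nonneg
  have hC1 : 24 * (C₀ + 1) ≤ m + k := by nlinarith
  have hR1 : 24 * (r : ℝ) ≤ m + k := by nlinarith
  have hm : m % r + m / r * r = m := by rw [mul_comm]; exact Nat.mod_add_div m r
  have hk : k % r + k / r * r = k := by rw [mul_comm]; exact Nat.mod_add_div k r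
  have hkl := Nat.mod_lt k hr
  -- The right end is moved to the next block boundary. If `k` is already a multiple of `r`, a full
  -- block is added, which is harmless.
  have hq : (k / r + 1) * r = k + (r - k % r) := by
    have : (k / r + 1) * r = k / r * r + r := by ring
    omega
  have h1 := M.push_mul_prodInf_le_lik (r := r) y hD χ (i := -((m / r : ℕ) : ℤ)) (j := -(m : ℤ))
    (l := m % r) (by
      have : (m : ℤ) = ((m % r : ℕ) : ℤ) + ((m / r : ℕ) : ℤ) * r := by exact_mod_cast hm.symm
      rw [neg_mul]; linarith) (m / r + (k / r + 1))
  have e1 : m % r + (m / r + (k / r + 1)) * r = (m + k) + (r - k % r) := by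
    rw [add_mul, hq]; omega
  rw [e1] at h1
  have h2 := h1.trans (M.lik_add_le y χ (-(m : ℤ)) (m + k) (r - k % r))
  have hpm : ((m / r : ℕ) : ℝ) ≤ m := by exact_mod_cast Nat.div_le_self m r
  have hqk : ((k / r : ℕ) : ℝ) ≤ k := by exact_mod_cast Nat.div_le_self k r
  have h3 : M.majorant y (-(m : ℤ) + (m + k : ℕ)) (r - k % r) ≤ expE (c * (m + (k + r)) + C₀) := by
    refine (M.majorant_le_of_le y (j := -(m : ℤ)) (n := m + (k + r)) (by push_cast; omega)
      (by push_cast; omega)).trans ((h.majorant_le m (k + r)).trans_eq ?_)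
    push_cast; rfl
  have h4 : expE (-(m + C₀) + -(c * (m + k + 1) + C₀)) ≤
      M.push χ (block y (-(m : ℤ)) (m % r)) D *
        M.prodInf r D y (-((m / r : ℕ) : ℤ)) (m / r + (k / r + 1)) := by
    rw [expE_add]
    refine mul_le_mul' (hχ _ (Nat.mod_lt m hr).le m) ((expE_mono ?_).trans (h.le_prodInf _ _))
    push_cast
    have := mul_le_mul_of_nonneg_left (add_le_add hpm (add_le_add_left hqk 1)) hc
    linarith
  -- The initial mass costs `m`, the minorant and the padding majorant each about `c (m + k)`. The
  -- threshold `hE` absorbs `C₀` and `r`, so `4 (c + 1)` is a sufficient rate.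
  refine (expE_mono ?_).trans (le_of_expE_mul_le (h4.trans h2) h3)
  have := mul_le_mul_of_nonneg_left hR1 hc
  have : c * 24 ≤ c * (m + k) := mul_le_mul_of_nonneg_left (by linarith) hc
  nlinarith

/-- Exponential lower bound for the largest likelihood of the window `[-m, 0)`. -/
lemma PathControl.le_supLkh (h : M.PathControl r K D c C₀ y) (hD : MeasurableSet D)
    (hne : D.Nonempty) (hr : 0 < r) (hc : 0 ≤ c) {m : ℕ}
    (hE : 24 * r * (C₀ + 1) ≤ m) :
    expE (-(4 * (c + 1) * m)) ≤ M.supLkh (block y (-m) m) := by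
  have hr1 : (1 : ℝ) ≤ r := by exact_mod_cast hr
  have h0 := h.nonneg
  have hC1 : 24 * (C₀ + 1) ≤ m := by nlinarith
  have hR1 : 24 * (r : ℝ) ≤ m := by nlinarith
  have hm : m % r + m / r * r = m := by rw [mul_comm]; exact Nat.mod_add_div m r
  have hml := Nat.mod_lt m hr
  -- No initial law has to reach `D` here: the window is padded on the left up to a block boundary,
  -- where a starting point in `D` is available.
  have hq : (m / r + 1) * r = (r - m % r) + m := by
    have : (m / r + 1) * r = m / r * r + r := by ring
    omega
  have h1 := (h.le_prodInf (m / r + 1) 0).trans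
    (M.prodInf_le_supLkh y hD hne (-((m / r + 1 : ℕ) : ℤ)) (m / r + 1 + 0))
  rw [add_zero, hq] at h1
  have h2 := h1.trans (M.supLkh_add_le y _ _ _)
  have e1 : -((m / r + 1 : ℕ) : ℤ) * r + ((r - m % r : ℕ) : ℤ) = -(m : ℤ) := by
    have : (((m / r + 1) * r : ℕ) : ℤ) = ((r - m % r : ℕ) : ℤ) + m := by exact_mod_cast hq
    push_cast at this ⊢
    linarith
  rw [e1] at h2
  have h3 : M.majorant y (-((m / r + 1 : ℕ) : ℤ) * r) (r - m % r) ≤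
      expE (c * (m + r) + C₀) := by
    refine (M.majorant_le_of_le y (j := -((m + r : ℕ) : ℤ)) (n := m + r + 0) ?_ ?_).trans
      ((h.majorant_le (m + r) 0).trans_eq (by push_cast; rw [add_zero]))
    · have : (((m / r + 1) * r : ℕ) : ℤ) = ((r - m % r : ℕ) : ℤ) + m := by exact_mod_cast hq
      push_cast at this ⊢
      rw [neg_mul]
      omega
    · rw [e1]; push_cast; omega
  refine (expE_mono ?_).trans (le_of_expE_mul_le h2 h3)
  have hpm : ((m / r : ℕ) : ℝ) ≤ m := by exact_mod_cast Nat.div_le_self m r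
  push_cast
  have := mul_le_mul_of_nonneg_left hR1 hc
  have := mul_le_mul_of_nonneg_left hpm hc
  have : c * 24 ≤ c * m := mul_le_mul_of_nonneg_left (by linarith) hc
  nlinarith

end HMM

/-! ### From two-term mixing bounds to log-likelihood ratios -/

/-- From a two-term bound for `A₁ B₂ - B₁ A₂` to a bound for the difference of the logarithms of
the ratios `A₁ / B₁` and `A₂ / B₂`. -/
lemma log_div_sub_log_div_le {A₁ B₁ A₂ B₂ θ ρ : ℝ≥0∞} {τ : ℝ} (hA₁ : A₁ ≠ 0) (hA₁' : A₁ ≠ ∞)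
    (hB₁ : B₁ ≠ 0) (hB₁' : B₁ ≠ ∞) (hA₂ : A₂ ≠ 0) (hA₂' : A₂ ≠ ∞) (hB₂ : B₂ ≠ 0) (hB₂' : B₂ ≠ ∞)
    (hθ : θ ≤ ρ) (hρ : ρ < 1) (hτ : 0 ≤ τ)
    (h : A₁ * B₂ ≤ B₁ * A₂ + θ * (A₁ * B₂ + B₁ * A₂) + ENNReal.ofReal τ * (B₁ * A₂)) :
    Real.log (A₁.toReal / B₁.toReal) - Real.log (A₂.toReal / B₂.toReal) ≤
      (2 * θ.toReal + τ) / (1 - ρ.toReal) := by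
  have hρ' : ρ ≠ ∞ := (hρ.trans ENNReal.one_lt_top).ne
  have hθ' : θ ≠ ∞ := ne_top_of_le_ne_top hρ' hθ
  have h1 : A₁.toReal * B₂.toReal ≤ B₁.toReal * A₂.toReal +
      θ.toReal * (A₁.toReal * B₂.toReal + B₁.toReal * A₂.toReal) +
      τ * (B₁.toReal * A₂.toReal) := by
    have := ENNReal.toReal_mono (by finiteness) h
    rwa [ENNReal.toReal_add (by finiteness) (by finiteness),
      ENNReal.toReal_add (by finiteness) (by finiteness), ENNReal.toReal_mul, ENNReal.toReal_mul,
      ENNReal.toReal_mul, ENNReal.toReal_add (by finiteness) (by finiteness), ENNReal.toReal_mul,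
      ENNReal.toReal_mul, ENNReal.toReal_mul, ENNReal.toReal_ofReal hτ, ENNReal.toReal_mul] at this
  have hθρ : θ.toReal ≤ ρ.toReal := ENNReal.toReal_mono hρ' hθ
  have hρ1 : ρ.toReal < 1 := by
    have := (ENNReal.toReal_lt_toReal hρ' ENNReal.one_ne_top).2 hρ
    simpa using this
  have hθ0 : 0 ≤ θ.toReal := ENNReal.toReal_nonneg
  have a1 := ENNReal.toReal_pos hA₁ hA₁'
  have b1 := ENNReal.toReal_pos hB₁ hB₁'
  have a2 := ENNReal.toReal_pos hA₂ hA₂'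
  have b2 := ENNReal.toReal_pos hB₂ hB₂'
  generalize A₁.toReal = A₁ at *
  generalize B₁.toReal = B₁ at *
  generalize A₂.toReal = A₂ at *
  generalize B₂.toReal = B₂ at *
  generalize θ.toReal = θ at *
  generalize ρ.toReal = ρ at *
  -- Dividing by `B₁ A₂` turns the hypothesis into `(x - 1)(1 - θ) ≤ 2θ + τ`, and `ln x ≤ x - 1`.
  obtain ⟨x, hx⟩ : ∃ x, x = A₁ * B₂ / (B₁ * A₂) := ⟨_, rfl⟩
  have hba : 0 < B₁ * A₂ := mul_pos b1 a2
  have hxpos : 0 < x := by rw [hx]; positivity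
  have e1 : A₁ * B₂ = x * (B₁ * A₂) := by rw [hx]; field_simp
  have h2 : x ≤ 1 + θ * (x + 1) + τ := by
    rw [e1] at h1
    refine le_of_mul_le_mul_right (a := B₁ * A₂) ?_ hba
    linarith
  have e2 : Real.log (A₁ / B₁) - Real.log (A₂ / B₂) = Real.log x := by
    rw [← Real.log_div (by positivity) (by positivity), hx]
    congr 1
    field_simp
  rw [e2]
  refine (Real.log_le_sub_one_of_pos hxpos).trans ?_
  rw [le_div_iff₀ (by linarith)]
  rcases le_total x 1 with hx1 | hx1
  · have : (x - 1) * (1 - ρ) ≤ 0 := mul_nonpos_of_nonpos_of_nonneg (by linarith) (by linarith)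
    linarith
  · have : (x - 1) * (1 - ρ) ≤ (x - 1) * (1 - θ) :=
      mul_le_mul_of_nonneg_left (by linarith) (by linarith)
    nlinarith

namespace HMM

variable {X S : Type*} [MeasurableSpace X] [MeasurableSpace S] {M : HMM X S} {r : ℕ}

/-- Existence of a local Doeblin set for which the blocks in `K` contract antisymmetric functions
at rate `ρ` and send mass at most `η` off the set. -/
def IsMixing (M : HMM X S) (r : ℕ) (K : Set (Fin r → S)) (ρ η : ℝ≥0∞) : Prop :=
  ∃ C εm εp lam φ, ∃ c : ℝ≥0∞, M.IsLocalDoeblin r C εm εp lam φ ∧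
    (∀ z ∈ K, c ≤ (εm z : ℝ≥0∞) / εp z) ∧
    (∀ z ∈ K, (⨆ x ∈ Cᶜ, M.lkh z x Set.univ) ≤ η * M.supLkh z) ∧ ρ + c * c = 1

/-- The rate at which windows mix, for blocks of length `r` and contraction factor `ρ`. -/
noncomputable def rate (r : ℕ) (ρ : ℝ≥0∞) : ℝ :=
  max (ρ.toReal ^ (1 / (12 * r : ℝ))) (Real.exp (-1))

lemma rate_pos (r : ℕ) (ρ : ℝ≥0∞) : 0 < rate r ρ := lt_max_of_lt_right (Real.exp_pos _)

lemma rate_lt_one {ρ : ℝ≥0∞} (hr : 0 < r) (hρ : ρ < 1) : rate r ρ < 1 := by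
  refine max_lt (Real.rpow_lt_one ENNReal.toReal_nonneg ?_ (by positivity)) ?_
  · have := (ENNReal.toReal_lt_toReal (hρ.trans ENNReal.one_lt_top).ne ENNReal.one_ne_top).2 hρ
    simpa using this
  · simp

lemma exp_neg_le_rate_pow (r : ℕ) (ρ : ℝ≥0∞) (n : ℕ) : Real.exp (-n) ≤ rate r ρ ^ n := by
  calc Real.exp (-n) = Real.exp (-1) ^ n := by rw [← Real.exp_nat_mul]; ring_nf
    _ ≤ _ := pow_le_pow_left₀ (Real.exp_pos _).le (le_max_right _ _) n

lemma pow_le_rate_pow {ρ : ℝ≥0∞} (hρ : ρ < 1) (hρ0 : ρ ≠ 0) {n e : ℕ}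
    (he : (n : ℝ) / (12 * r) ≤ e) : (ρ ^ e).toReal ≤ rate r ρ ^ n := by
  have h0 : 0 < ρ.toReal := ENNReal.toReal_pos hρ0 (hρ.trans ENNReal.one_lt_top).ne
  have h1 : ρ.toReal ≤ 1 := by
    have := ENNReal.toReal_mono ENNReal.one_ne_top hρ.le
    simpa using this
  calc (ρ ^ e).toReal = ρ.toReal ^ (e : ℝ) := by rw [ENNReal.toReal_pow, Real.rpow_natCast]
    _ ≤ ρ.toReal ^ ((n : ℝ) / (12 * r)) := Real.rpow_le_rpow_of_exponent_ge h0 h1 he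
    _ = (ρ.toReal ^ (1 / (12 * r : ℝ))) ^ n := by
        rw [← Real.rpow_natCast, ← Real.rpow_mul h0.le]; congr 1; ring
    _ ≤ _ := pow_le_pow_left₀ (Real.rpow_nonneg h0.le _) (le_max_left _ _) n

variable {K : Set (Fin r → S)} {D : Set X} {c C₀ : ℝ} {y : ℤ → S} {ρ : ℝ≥0∞}

/-- The two-term mixing bound along a controlled path. -/
theorem PathControl.two_term (h : M.PathControl r K D c C₀ y) (hr : 0 < r) (hc : 0 ≤ c)
    (hmix : M.IsMixing r K ρ (expE (-(48 * r * (25 * (c + 1)))))) {m k : ℕ}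
    (hE : 24 * r * (C₀ + 1) ≤ m + k) {a b : X → ℝ≥0∞} (ha : Measurable a) (hb : Measurable b)
    {s : ℝ≥0∞} (hs : s ≠ ∞) (hB : ∃ B : ℝ≥0, (∀ x, a x ≤ B) ∧ ∀ x, b x ≤ B)
    (hab : ∀ x x', a x * b x' ≤ s) :
    ∃ e : ℕ, 1 ≤ e ∧ ((m + k : ℕ) : ℝ) / (12 * r) ≤ e ∧
      ∀ (μ μ' : Measure X) [IsFiniteMeasure μ] [IsFiniteMeasure μ'],
        (∫⁻ x, M.act y (-m) (m + k) a x ∂μ) * ∫⁻ x, M.act y (-m) (m + k) b x ∂μ' ≤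
          (∫⁻ x, M.act y (-m) (m + k) b x ∂μ) * (∫⁻ x, M.act y (-m) (m + k) a x ∂μ') +
          ρ ^ e * ((∫⁻ x, M.act y (-m) (m + k) a x ∂μ) * (∫⁻ x, M.act y (-m) (m + k) b x ∂μ') +
            (∫⁻ x, M.act y (-m) (m + k) b x ∂μ) * ∫⁻ x, M.act y (-m) (m + k) a x ∂μ') +
          expE (-(21 * (c + 1) * (m + k))) * s * (μ Set.univ * μ' Set.univ) := by
  obtain ⟨C, εm, εp, lam, φ, c₁, hLD, hc₁, hη, hρ⟩ := hmix
  have hW := mixes_window hLD hc₁ hη hρ (expE_ne_top _) hs h.majorant_ne_top ha hb hB hab m k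
  obtain ⟨u, hu⟩ : ∃ u : ℝ, u = ((m + k : ℕ) : ℝ) / r := ⟨_, rfl⟩
  have hr0 : (0 : ℝ) < r := by exact_mod_cast hr
  have hu1 : 24 * (C₀ + 1) ≤ u := by
    rw [hu, le_div_iff₀ hr0]; push_cast; linarith
  have h0 := h.nonneg
  obtain ⟨N, hN⟩ : ∃ N : ℕ, N = m / r + k / r := ⟨_, rfl⟩
  have hNu : u - 2 ≤ N := by
    have h1 : m < (m / r + 1) * r := by
      rw [add_mul, one_mul]; exact Nat.lt_div_mul_add hr
    have h2 : k < (k / r + 1) * r := by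
      rw [add_mul, one_mul]; exact Nat.lt_div_mul_add hr
    have h3 : m + k ≤ (N + 2) * r := by rw [hN]; nlinarith
    have h4 : ((m + k : ℕ) : ℝ) ≤ (N + 2) * r := by exact_mod_cast h3
    rw [hu, sub_le_iff_le_add, div_le_iff₀ hr0]
    exact h4
  rw [← hN] at hW
  have hbad : (badCount K y (-((m / r : ℕ) : ℤ)) N : ℝ) ≤ N / 3 + C₀ := by
    rw [hN]; simpa using h.badCount_le (m / r) (k / r)
  obtain ⟨B, hBdef⟩ : ∃ B : ℕ, B = badCount K y (-((m / r : ℕ) : ℤ)) N := ⟨_, rfl⟩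
  rw [← hBdef] at hW hbad
  -- Twice the bad blocks takes about `2N/3`, and `2t` about `N/6`. This leaves `N/6` up to
  -- constants, and the threshold `hE` is large enough for at least `u / 12` to remain.
  obtain ⟨t, ht⟩ : ∃ t : ℕ, t = N / 12 := ⟨_, rfl⟩
  have ht1 : (12 * t : ℝ) ≤ N := by
    have : 12 * t ≤ N := by omega
    exact_mod_cast this
  have ht2 : (N : ℝ) ≤ 12 * t + 12 := by
    have : N ≤ 12 * t + 12 := by omega
    exact_mod_cast this
  have hsub : 2 * B + 1 + 2 * t ≤ N := by
    have : (2 * B + 1 + 2 * t : ℝ) ≤ N := by linarith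
    exact_mod_cast this
  have he : ((N - (2 * B + 1) - 2 * t : ℕ) : ℝ) = N - (2 * B + 1) - 2 * t := by
    rw [Nat.cast_sub (by omega), Nat.cast_sub (by omega)]; push_cast; ring
  have heu : u / 12 ≤ ((N - (2 * B + 1) - 2 * t : ℕ) : ℝ) := by
    rw [he]; linarith
  refine ⟨N - (2 * B + 1) - 2 * t, ?_, ?_, ?_⟩
  · have : (0 : ℝ) < ((N - (2 * B + 1) - 2 * t : ℕ) : ℝ) := by linarith
    exact_mod_cast this
  · refine le_trans (le_of_eq ?_) heu
    rw [hu, div_div, mul_comm]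
  · intro μ μ' _ _
    refine (hW.lintegral_le μ μ' t).trans ?_
    have hmaj : M.majorant y (-m) (m + k) ≤ expE (2 * (c + 1) * (m + k)) := by
      have : 24 * (C₀ + 1) ≤ m + k := by
        have : (1 : ℝ) ≤ r := by exact_mod_cast hr
        nlinarith
      exact h.majorant_le_expE (by linarith) le_rfl (q := k) (by push_cast; omega)
        (by
          have : (0 : ℝ) ≤ m + k := by positivity
          linarith) hc
    -- Here `t ≥ u / 48` with `u = (m + k) / r`, so `η ^ t` decays at rate `25 (c + 1)`. The two
    -- majorants use up `4 (c + 1)`, which leaves `21 (c + 1)`.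
    have hpow : expE (-(48 * r * (25 * (c + 1)))) ^ t ≤ expE (-(25 * (c + 1) * (m + k))) := by
      rw [expE_pow]
      refine expE_mono ?_
      have h1 : u ≤ 48 * t := by linarith
      rw [hu, div_le_iff₀ hr0] at h1
      push_cast at h1
      have := mul_le_mul_of_nonneg_left h1 (show 0 ≤ 25 * (c + 1) by linarith)
      linarith
    have hfin : expE (-(48 * r * (25 * (c + 1)))) ^ t *
        (M.majorant y (-m) (m + k) * M.majorant y (-m) (m + k) * s) ≤
        expE (-(21 * (c + 1) * (m + k))) * s := by
      calc _ ≤ expE (-(25 * (c + 1) * (m + k))) *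
            (expE (2 * (c + 1) * (m + k)) * expE (2 * (c + 1) * (m + k)) * s) := by gcongr
        _ = _ := by
          rw [← expE_add, ← mul_assoc, ← expE_add]
          congr 2
          ring
    gcongr

variable (M) in
lemma lintegral_act_ne_top (h : ∀ j n, M.majorant y j n ≠ ∞) {f : X → ℝ≥0∞} (hf : Measurable f)
    {B : ℝ≥0∞} (hB : B ≠ ∞) (hfB : ∀ x, f x ≤ B) (μ : Measure X) [IsFiniteMeasure μ] (j : ℤ)
    (n : ℕ) : ∫⁻ x, M.act y j n f x ∂μ ≠ ∞ := by
  refine ((lintegral_mono fun x => M.act_le y j n hf hfB x).trans_lt ?_).ne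
  rw [lintegral_const]
  exact ENNReal.mul_lt_top (ENNReal.mul_lt_top (h j n).lt_top hB.lt_top) (measure_lt_top μ _)

variable (M) in
lemma lintegral_act_ne_zero (hg : ∀ x y, 0 < M.g x y) {f : X → ℝ≥0∞} (hf : Measurable f)
    (hpos : ∀ x, 0 < f x) {μ : Measure X} (hμ : μ Set.univ ≠ 0) (j : ℤ)
    (n : ℕ) : ∫⁻ x, M.act y j n f x ∂μ ≠ 0 := by
  refine ((lintegral_pos_iff_support (M.measurable_act _ _ _ hf)).2 ?_).ne'
  have : Function.support (M.act y j n f) = Set.univ :=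
    Set.eq_univ_of_forall fun x' => (M.act_pos y hg _ _ hf hpos x').ne'
  rw [this]
  exact pos_iff_ne_zero.2 hμ

/-- Comparison of two one-step predictive log-likelihoods, for arbitrary finite initial measures. -/
theorem PathControl.log_sub_log_le (h : M.PathControl r K D c C₀ y) (hr : 0 < r) (hc : 0 ≤ c)
    (hg : ∀ x y, 0 < M.g x y) (hρ : ρ < 1) (hρ0 : ρ ≠ 0)
    (hmix : M.IsMixing r K ρ (expE (-(48 * r * (25 * (c + 1)))))) {m k : ℕ}
    (hE : 24 * r * (C₀ + 1) ≤ m + k) (μ μ' : Measure X) [IsFiniteMeasure μ] [IsFiniteMeasure μ']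
    (hμ : μ Set.univ ≠ 0) (hμ' : μ' Set.univ ≠ 0)
    (hlow : M.supG (y k) * (μ Set.univ * μ' Set.univ) ≤ 2 * expE (20 * (c + 1) * (m + k)) *
      ((∫⁻ x, M.act y (-m) (m + k) (fun _ => 1) x ∂μ) *
        ∫⁻ x, M.act y (-m) (m + k) (fun x => (M.g x (y k) : ℝ≥0∞)) x ∂μ')) :
    Real.log ((∫⁻ x, M.act y (-m) (m + k) (fun x => (M.g x (y k) : ℝ≥0∞)) x ∂μ).toReal /
        (∫⁻ x, M.act y (-m) (m + k) (fun _ => 1) x ∂μ).toReal) -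
      Real.log ((∫⁻ x, M.act y (-m) (m + k) (fun x => (M.g x (y k) : ℝ≥0∞)) x ∂μ').toReal /
        (∫⁻ x, M.act y (-m) (m + k) (fun _ => 1) x ∂μ').toReal) ≤
      4 / (1 - ρ.toReal) * rate r ρ ^ (k + m) := by
  have hGtop : M.supG (y k) ≠ ∞ :=
    ne_top_of_le_ne_top (h.majorant_ne_top k 1) (M.supG_le_majorant y k)
  have hgm := M.measurable_g_left (y k)
  have hgG : ∀ x, (M.g x (y k) : ℝ≥0∞) ≤ M.supG (y k) := le_iSup (fun x => (M.g x (y k) : ℝ≥0∞))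
  have hgpos : ∀ x, 0 < (M.g x (y k) : ℝ≥0∞) := fun x => by simpa using hg x (y k)
  obtain ⟨e, he1, he2, hle⟩ := h.two_term hr hc hmix hE hgm
    (b := fun _ => 1) measurable_const hGtop
    ⟨max 1 (M.supG (y k)).toNNReal, fun x => (hgG x).trans (by
      rw [← ENNReal.coe_toNNReal hGtop]; exact_mod_cast le_max_right _ _), fun x => by
      exact_mod_cast le_max_left _ _⟩ (fun x x' => by rw [mul_one]; exact hgG x)
  have hρtop : ρ ≠ ∞ := (hρ.trans ENNReal.one_lt_top).ne
  have hnt : ∀ ν : Measure X, IsFiniteMeasure ν →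
      ∫⁻ x, M.act y (-m) (m + k) (fun x => (M.g x (y k) : ℝ≥0∞)) x ∂ν ≠ ∞ := fun ν _ =>
    M.lintegral_act_ne_top h.majorant_ne_top hgm hGtop hgG ν _ _
  have hnt1 : ∀ ν : Measure X, IsFiniteMeasure ν →
      ∫⁻ x, M.act y (-m) (m + k) (fun _ => 1) x ∂ν ≠ ∞ := fun ν _ =>
    M.lintegral_act_ne_top h.majorant_ne_top measurable_const ENNReal.one_ne_top
      (fun _ => le_rfl) ν _ _
  have hn0 : ∀ ν : Measure X, ν Set.univ ≠ 0 →
      ∫⁻ x, M.act y (-m) (m + k) (fun x => (M.g x (y k) : ℝ≥0∞)) x ∂ν ≠ 0 := fun ν hν =>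
    M.lintegral_act_ne_zero hg hgm hgpos hν _ _
  have hn01 : ∀ ν : Measure X, ν Set.univ ≠ 0 →
      ∫⁻ x, M.act y (-m) (m + k) (fun _ => 1) x ∂ν ≠ 0 := fun ν hν =>
    M.lintegral_act_ne_zero hg measurable_const (by simp) hν _ _
  have hρe : ρ ^ e ≤ ρ := by
    calc ρ ^ e ≤ ρ ^ 1 := pow_le_pow_right_of_le_one' hρ.le he1
      _ = ρ := pow_one ρ
  -- By `hlow` the error becomes a multiple of the cross term: the rate `21 (c + 1)` beats `20 (c +
  -- 1)` by at least one, whence `τ = 2 exp (-(m + k))`. The constant `4` collects `2θ` and `τ`,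
  -- each at most `2 β ^ (k + m)`.
  refine (log_div_sub_log_div_le (τ := 2 * Real.exp (-((m : ℝ) + k)))
    (hn0 μ hμ) (hnt μ ‹_›) (hn01 μ hμ) (hnt1 μ ‹_›)
    (hn0 μ' hμ') (hnt μ' ‹_›) (hn01 μ' hμ') (hnt1 μ' ‹_›) hρe hρ (by positivity)
    ((hle μ μ').trans ?_)).trans ?_
  · have hE2 : expE (-(21 * (c + 1) * (m + k))) * expE (20 * (c + 1) * (m + k)) ≤
        expE (-((m : ℝ) + k)) := by
      rw [← expE_add]
      refine expE_mono ?_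
      have : (0 : ℝ) ≤ m + k := by positivity
      nlinarith [mul_nonneg hc this]
    refine add_le_add_right ?_ _
    rw [mul_assoc]
    generalize (∫⁻ x, M.act y (-m) (m + k) (fun _ => 1) x ∂μ) *
      ∫⁻ x, M.act y (-m) (m + k) (fun x => (M.g x (y k) : ℝ≥0∞)) x ∂μ' = I at hlow ⊢
    calc expE (-(21 * (c + 1) * (m + k))) * (M.supG (y k) * (μ Set.univ * μ' Set.univ))
        ≤ expE (-(21 * (c + 1) * (m + k))) * (2 * expE (20 * (c + 1) * (m + k)) * I) := by gcongr
      _ = 2 * (expE (-(21 * (c + 1) * (m + k))) * expE (20 * (c + 1) * (m + k))) * I := by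
          ac_rfl
      _ ≤ 2 * expE (-((m : ℝ) + k)) * I := by gcongr
      _ = _ := by
          rw [ENNReal.ofReal_mul (by norm_num)]
          simp [expE]
  · have h1 : ρ.toReal < 1 := by
      have := (ENNReal.toReal_lt_toReal hρtop ENNReal.one_ne_top).2 hρ
      simpa using this
    rw [div_mul_eq_mul_div]
    refine div_le_div_of_nonneg_right ?_ (by linarith)
    have h2 := pow_le_rate_pow (r := r) hρ hρ0 he2
    have h3 := exp_neg_le_rate_pow r ρ (m + k)
    rw [add_comm k m]
    push_cast at h3
    linarith

end HMM

/-! ### Predictive likelihoods and forgetting on controlled paths -/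

namespace HMM

variable {X S : Type*} [MeasurableSpace X] [MeasurableSpace S] {M : HMM X S} {r : ℕ}

variable (M) in
lemma logPredLik_block (χ : ProbabilityMeasure X) (y : ℤ → S) (m k : ℕ) :
    M.logPredLik χ (block y (-m) (m + k + 1)) =
      Real.log ((∫⁻ x, M.act y (-m) (m + k) (fun x => (M.g x (y k) : ℝ≥0∞)) x ∂(χ : Measure X)).toReal /
        (∫⁻ x, M.act y (-m) (m + k) (fun _ => 1) x ∂(χ : Measure X)).toReal) := by
  rw [logPredLik, init_block, lik_succ, lik_eq]
  have : -(m : ℤ) + (m + k : ℕ) = k := by push_cast; ring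
  rw [this]

variable (M) in
lemma lik_block_succ (χ : ProbabilityMeasure X) (y : ℤ → S) (m k : ℕ) :
    M.lik χ (block y (-m) (m + k + 1)) =
      ∫⁻ x, M.act y (-m) (m + k) (fun x => (M.g x (y k) : ℝ≥0∞)) x ∂(χ : Measure X) := by
  have : -(m : ℤ) + (m + k : ℕ) = k := by push_cast; ring
  rw [lik_succ, this]

variable (M) in
-- A start at `-m - 1` is a start at `-m` from a one-step unnormalized measure. Predictive ratios
-- ignore normalization, so both starts can be compared over the same window.
lemma lik_block_pred (χ : ProbabilityMeasure X) (y : ℤ → S) (m n : ℕ) :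
    M.lik χ (block y (-m - 1) (n + 1)) =
      ∫⁻ x, M.act y (-m) n (fun _ => 1) x ∂M.push χ (block y (-m - 1) 1) := by
  rw [add_comm n 1, lik_add]
  have : -(m : ℤ) - 1 + (1 : ℕ) = -m := by push_cast; ring
  rw [this]

variable (M) in
lemma lik_block_pred_succ (χ : ProbabilityMeasure X) (y : ℤ → S) (m k : ℕ) :
    M.lik χ (block y (-m - 1) (m + k + 2)) =
      ∫⁻ x, M.act y (-m) (m + k) (fun x => (M.g x (y k) : ℝ≥0∞)) x
        ∂M.push χ (block y (-m - 1) 1) := by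
  have : -(m : ℤ) + (m + k : ℕ) = k := by push_cast; ring
  rw [show m + k + 2 = (m + k + 1) + 1 by ring, lik_block_pred, act_succ_one, this]

variable (M) in
lemma logPredLik_block_pred (χ : ProbabilityMeasure X) (y : ℤ → S) (m k : ℕ) :
    M.logPredLik χ (block y (-m - 1) (m + k + 2)) =
      Real.log ((∫⁻ x, M.act y (-m) (m + k) (fun x => (M.g x (y k) : ℝ≥0∞)) x
          ∂M.push χ (block y (-m - 1) 1)).toReal /
        (∫⁻ x, M.act y (-m) (m + k) (fun _ => 1) x ∂M.push χ (block y (-m - 1) 1)).toReal) := by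
  rw [← lik_block_pred_succ, ← lik_block_pred, logPredLik, init_block]

variable {K : Set (Fin r → S)} {D : Set X} {c C₀ : ℝ} {y : ℤ → S} {ρ : ℝ≥0∞}

/-- A single rate, twice the original one, covers the windows of length `n`, `n + 1` and `n + 2`
that occur together in the comparisons. -/
lemma PathControl.le_lik_of_le (h : M.PathControl r K D c C₀ y) (hD : MeasurableSet D)
    (hr : 0 < r) (hc : 0 ≤ c) {χ : ProbabilityMeasure X} (hχ : M.InitControl r D χ C₀ y)
    {m k n : ℕ} (hE : 24 * r * (C₀ + 1) ≤ n) (h1 : n ≤ m + k) (h2 : m + k ≤ n + 2) :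
    expE (-(8 * (c + 1) * n)) ≤ M.lik χ (block y (-m) (m + k)) := by
  have h1' : (n : ℝ) ≤ m + k := by exact_mod_cast h1
  have h2' : (m + k : ℝ) ≤ n + 2 := by exact_mod_cast h2
  have hr1 : (1 : ℝ) ≤ r := by exact_mod_cast hr
  have h0 := h.nonneg
  have hn : (24 : ℝ) ≤ n := by nlinarith
  refine (expE_mono ?_).trans (h.le_lik hD hr hc hχ (hE.trans h1'))
  have : (c + 1) * (m + k) ≤ (c + 1) * (2 * n) :=
    mul_le_mul_of_nonneg_left (by linarith) (by linarith)
  linarith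

/-- In the application `B` is the likelihood of a measure in the near set, about which nothing else
is known. Membership gives `B ≥ L / (2G)`, of order `exp (-10u)`. With `A` of order `exp (-8u)` and
`G` of order `exp (2u)`, the total is `20u`. -/
lemma expE_le_two_mul {u : ℝ} {B A G L : ℝ≥0∞} (hG : G ≤ expE (2 * u))
    (hL : expE (-(8 * u)) ≤ L) (hB : 1 / 2 * L ≤ G * B) (hA : expE (-(8 * u)) ≤ A) :
    G ≤ 2 * expE (20 * u) * (B * A) := by
  have h1 : L ≤ 2 * (expE (2 * u) * B) := by
    calc L = 2 * (1 / 2 * L) := by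
          rw [← mul_assoc, one_div, ENNReal.mul_inv_cancel (by simp) (by simp), one_mul]
      _ ≤ 2 * (G * B) := by gcongr
      _ ≤ _ := by gcongr
  calc G ≤ expE (2 * u) := hG
    _ = expE (18 * u) * (expE (-(8 * u)) * expE (-(8 * u))) := by
        rw [← expE_add, ← expE_add]; congr 1; ring
    _ ≤ expE (18 * u) * (2 * (expE (2 * u) * B) * A) := by gcongr; exact hL.trans h1
    _ = 2 * (expE (18 * u) * expE (2 * u)) * (B * A) := by ring
    _ = _ := by rw [← expE_add]; congr 3; ring

variable (M) in
lemma mem_nearSet_block (χ χt : ProbabilityMeasure X) (y : ℤ → S) (m k : ℕ) :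
    χt ∈ M.nearSet (block y (-m) (m + k + 1)) χ ↔
      1 / 2 * M.lik χ (block y (-m) (m + k + 1)) ≤
        M.supG (y k) * M.lik χt (block y (-m) (m + k)) := by
  have : -(m : ℤ) + (m + k : ℕ) = k := by push_cast; ring
  rw [nearSet, Set.mem_ofPred_eq, init_block, block_last, this]

/-- Comparison of the predictive log-likelihoods of `χt`, in the near set of `χ`, and of `χ'`. -/
theorem PathControl.logPredLik_sub_le (h : M.PathControl r K D c C₀ y) (hD : MeasurableSet D)
    (hr : 0 < r) (hc : 0 ≤ c) (hg : ∀ x y, 0 < M.g x y) (hρ : ρ < 1) (hρ0 : ρ ≠ 0)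
    (hmix : M.IsMixing r K ρ (expE (-(48 * r * (25 * (c + 1))))))
    {χ χ' χt : ProbabilityMeasure X} (hχ : M.InitControl r D χ C₀ y)
    (hχ' : M.InitControl r D χ' C₀ y) {m k : ℕ} (hE : 24 * r * (C₀ + 1) ≤ m + k)
    (hχt : χt ∈ M.nearSet (block y (-m) (m + k + 1)) χ) :
    M.logPredLik χt (block y (-m) (m + k + 1)) - M.logPredLik χ' (block y (-m) (m + k + 1)) ≤
      4 / (1 - ρ.toReal) * rate r ρ ^ (k + m) := by
  rw [logPredLik_block, logPredLik_block]
  refine h.log_sub_log_le hr hc hg hρ hρ0 hmix hE _ _ (by simp) (by simp) ?_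
  have hE' : 24 * r * (C₀ + 1) ≤ ((m + k : ℕ) : ℝ) := by push_cast; exact hE
  have h1 := h.le_lik_of_le hD hr hc hχ (m := m) (k := k + 1) hE' (by omega) (by omega)
  have h2 := h.le_lik_of_le hD hr hc hχ' (m := m) (k := k + 1) hE' (by omega) (by omega)
  rw [← add_assoc] at h1 h2
  have hr1 : (1 : ℝ) ≤ r := by exact_mod_cast hr
  have h0 := h.nonneg
  have hn : 24 * (C₀ + 1) ≤ (m + k : ℝ) := by nlinarith
  have hG : M.supG (y k) ≤ expE (2 * ((c + 1) * (m + k))) := by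
    refine (M.supG_le_majorant y k).trans ?_
    rw [← mul_assoc]
    exact h.majorant_le_expE (by linarith) (p := 0) (q := k + 1) (by simp) (by push_cast; rfl)
      (by push_cast; have : (0 : ℝ) ≤ m := by positivity
          linarith) hc
  rw [mem_nearSet_block] at hχt
  rw [← lik_eq, ← lik_block_succ]
  have e1 : ∀ a : ℝ, a * (c + 1) * ((m + k : ℕ) : ℝ) = a * ((c + 1) * (m + k)) := fun a => by
    push_cast; ring
  rw [e1] at h1 h2
  rw [measure_univ, measure_univ, mul_one, mul_one, mul_assoc 20 (c + 1)]
  exact expE_le_two_mul hG h1 hχt h2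

/-- Comparison of the predictive log-likelihoods started at the times `-m` and `-m - 1`. -/
theorem PathControl.abs_logPredLik_sub_le (h : M.PathControl r K D c C₀ y) (hD : MeasurableSet D)
    (hr : 0 < r) (hc : 0 ≤ c) (hg : ∀ x y, 0 < M.g x y) (hρ : ρ < 1) (hρ0 : ρ ≠ 0)
    (hmix : M.IsMixing r K ρ (expE (-(48 * r * (25 * (c + 1))))))
    {χ : ProbabilityMeasure X} (hχ : M.InitControl r D χ C₀ y) {m k : ℕ}
    (hE : 24 * r * (C₀ + 1) ≤ m + k) :
    |M.logPredLik χ (block y (-m) (m + k + 1)) - M.logPredLik χ (block y (-m - 1) (m + k + 2))| ≤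
      4 / (1 - ρ.toReal) * rate r ρ ^ (k + m) := by
  rw [logPredLik_block, logPredLik_block_pred]
  have hμle := M.push_univ_le y χ (-m - 1) 1
  have hfin : IsFiniteMeasure (M.push χ (block y (-m - 1) 1)) :=
    ⟨hμle.trans_lt (h.majorant_ne_top _ _).lt_top⟩
  have hμ0 : M.push χ (block y (-m - 1) 1) Set.univ ≠ 0 := (M.lik_pos y hg χ (-m - 1) 1).ne'
  have hE' : 24 * r * (C₀ + 1) ≤ ((m + k : ℕ) : ℝ) := by push_cast; exact hE
  have h1 := h.le_lik_of_le hD hr hc hχ (m := m) (k := k) hE' (by omega) (by omega)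
  have h2 := h.le_lik_of_le hD hr hc hχ (m := m) (k := k + 1) hE' (by omega) (by omega)
  have h3 := h.le_lik_of_le hD hr hc hχ (m := m + 1) (k := k) hE' (by omega) (by omega)
  have h4 := h.le_lik_of_le hD hr hc hχ (m := m + 1) (k := k + 1) hE' (by omega) (by omega)
  have em : -((m + 1 : ℕ) : ℤ) = -m - 1 := by push_cast; ring
  rw [← add_assoc] at h2
  rw [em, show m + 1 + k = m + k + 1 by ring] at h3
  rw [em, show m + 1 + (k + 1) = m + k + 2 by ring] at h4
  rw [lik_eq] at h1
  rw [lik_block_succ] at h2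
  rw [lik_block_pred] at h3
  rw [lik_block_pred_succ] at h4
  have hr1 : (1 : ℝ) ≤ r := by exact_mod_cast hr
  have h0 := h.nonneg
  have hn : 24 * (C₀ + 1) ≤ (m + k : ℝ) := by nlinarith
  have hm0 : (0 : ℝ) ≤ m := by positivity
  have hk0 : (0 : ℝ) ≤ k := by positivity
  have hG : M.supG (y k) ≤ expE (2 * (c + 1) * (m + k)) :=
    (M.supG_le_majorant y k).trans (h.majorant_le_expE (by linarith) (p := 0) (q := k + 1)
      (by simp) (by push_cast; rfl) (by push_cast; linarith) hc)
  have hμ : M.push χ (block y (-m - 1) 1) Set.univ ≤ expE (2 * (c + 1) * (m + k)) :=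
    hμle.trans (h.majorant_le_expE (by linarith) (p := m + 1) (q := 0)
      (by push_cast; omega) (by push_cast; omega) (by push_cast; linarith) hc)
  -- The budget `20 (c + 1)` is `2 + 2` for `‖g_{y_k}‖_∞` and the mass of the one-step measure, and
  -- `8 + 8` for the two likelihoods.
  have key : ∀ A B : ℝ≥0∞, expE (-(8 * (c + 1) * ((m + k : ℕ) : ℝ))) ≤ A →
      expE (-(8 * (c + 1) * ((m + k : ℕ) : ℝ))) ≤ B →
      M.supG (y k) * M.push χ (block y (-m - 1) 1) Set.univ ≤
        2 * expE (20 * (c + 1) * (m + k)) * (A * B) := by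
    intro A B hA hB
    calc _ ≤ expE (2 * (c + 1) * (m + k)) * expE (2 * (c + 1) * (m + k)) := mul_le_mul' hG hμ
      _ = expE (20 * (c + 1) * (m + k)) * (expE (-(8 * (c + 1) * ((m + k : ℕ) : ℝ))) *
          expE (-(8 * (c + 1) * ((m + k : ℕ) : ℝ)))) := by
          rw [← expE_add, ← expE_add, ← expE_add]; congr 1; push_cast; ring
      _ ≤ expE (20 * (c + 1) * (m + k)) * (A * B) := by gcongr
      _ ≤ 2 * expE (20 * (c + 1) * (m + k)) * (A * B) := by
          gcongr
          exact le_mul_of_one_le_left zero_le one_le_two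
  have hχ1 : (χ : Measure X) Set.univ = 1 := measure_univ
  rw [abs_sub_le_iff]
  constructor
  · refine h.log_sub_log_le hr hc hg hρ hρ0 hmix hE _ _ (by simp) hμ0 ?_
    rw [hχ1, one_mul]
    exact key _ _ h1 h4
  · refine h.log_sub_log_le hr hc hg hρ hρ0 hmix hE _ _ hμ0 (by simp) ?_
    rw [hχ1, mul_one]
    exact key _ _ h3 h2

variable (M) in
/-- A bound for `Δ_{χ,χ'}(h, 1)` from bounds for the nonnegative function `h + B`. -/
lemma abs_Delta_one_le {n : ℕ} {z : Fin n → S} (hz : M.supLkh z ≠ ∞) {h : X → ℝ}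
    (hm : Measurable h) {B : ℝ} (hB : ∀ x, |h x| ≤ B) {τ : ℝ} (hτ : 0 ≤ τ)
    (H : ∀ χ χ' : ProbabilityMeasure X,
      (∫⁻ x, ENNReal.ofReal (h x + B) ∂M.push χ z) * M.lik χ' z ≤
        M.lik χ z * (∫⁻ x, ENNReal.ofReal (h x + B) ∂M.push χ' z) + ENNReal.ofReal τ)
    (χ χ' : ProbabilityMeasure X) : |M.Delta χ χ' z h (fun _ => 1)| ≤ τ := by
  have hlik : ∀ χ : ProbabilityMeasure X, M.lik χ z ≠ ∞ := fun χ =>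
    ne_top_of_le_ne_top hz (M.lik_le_supLkh χ z)
  have hfin : ∀ χ : ProbabilityMeasure X, IsFiniteMeasure (M.push χ z) := fun χ =>
    ⟨(hlik χ).lt_top⟩
  have hint : ∀ χ : ProbabilityMeasure X, Integrable h (M.push χ z) := fun χ =>
    (integrable_const B).mono' hm.aestronglyMeasurable (Filter.Eventually.of_forall hB)
  have e1 : ∀ χ : ProbabilityMeasure X, (∫⁻ x, ENNReal.ofReal (h x + B) ∂M.push χ z).toReal =
      ∫ x, h x ∂M.push χ z + B * (M.lik χ z).toReal := by
    intro χ
    rw [← integral_eq_lintegral_of_nonneg_ae, integral_add (hint χ) (integrable_const B),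
      integral_const, smul_eq_mul, mul_comm B]
    · rfl
    · exact Filter.Eventually.of_forall fun x => by
        have := (abs_le.1 (hB x)).1
        simp only [Pi.zero_apply]
        linarith
    · exact (hm.add_const B).aestronglyMeasurable
  have hI : ∀ χ : ProbabilityMeasure X, ∫⁻ x, ENNReal.ofReal (h x + B) ∂M.push χ z ≠ ∞ :=
    fun χ => ((hint χ).add (integrable_const B)).lintegral_lt_top.ne
  have e2 : ∀ χ : ProbabilityMeasure X, ∫ _, (1 : ℝ) ∂M.push χ z = (M.lik χ z).toReal := by
    intro χ
    rw [integral_const, smul_eq_mul, mul_one]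
    rfl
  -- Adding the constant `B` to `h` leaves `Δ(h, 1)` unchanged because `Δ(1, 1) = 0`. The lower
  -- bound then follows by exchanging `χ` and `χ'`.
  have H' : ∀ χ χ' : ProbabilityMeasure X, M.Delta χ χ' z h (fun _ => 1) ≤ τ := by
    intro χ χ'
    have h1 := hlik χ
    have h2 := hlik χ'
    have h3 := hI χ
    have h4 := hI χ'
    have := ENNReal.toReal_mono (by finiteness) (H χ χ')
    rw [ENNReal.toReal_add (by finiteness) (by finiteness), ENNReal.toReal_mul,
      ENNReal.toReal_mul, ENNReal.toReal_ofReal hτ, e1, e1] at this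
    rw [Delta, e2, e2]
    linarith
  rw [abs_le]
  refine ⟨?_, H' χ χ'⟩
  have := H' χ' χ
  rw [Delta] at this ⊢
  linarith

variable (M) in
lemma lintegral_ofReal_push_le {h : X → ℝ} {B : ℝ} (hB : ∀ x, |h x| ≤ B)
    (χ : ProbabilityMeasure X) {n : ℕ} (z : Fin n → S) :
    ∫⁻ x, ENNReal.ofReal (h x + B) ∂M.push χ z ≤ ENNReal.ofReal (2 * B) * M.supLkh z := by
  calc _ ≤ ∫⁻ _, ENNReal.ofReal (2 * B) ∂M.push χ z := lintegral_mono fun x =>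
        ENNReal.ofReal_le_ofReal (by have := (abs_le.1 (hB x)).2; linarith)
    _ = ENNReal.ofReal (2 * B) * M.lik χ z := by rw [lintegral_const]; rfl
    _ ≤ _ := by gcongr; exact M.lik_le_supLkh χ z

variable (M) in
-- A bound without decay, uniform in the initial laws, which serves for the windows that are too
-- short to mix.
lemma abs_Delta_one_div_le {n : ℕ} {z : Fin n → S} (hz : M.supLkh z ≠ ∞) {h : X → ℝ}
    (hm : Measurable h) {B : ℝ} (hB0 : 0 ≤ B) (hB : ∀ x, |h x| ≤ B)
    (χ χ' : ProbabilityMeasure X) :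
    |M.Delta χ χ' z h (fun _ => 1)| / (M.supLkh z).toReal ^ 2 ≤ 2 * B := by
  refine div_le_of_le_mul₀ (by positivity) (by positivity) ?_
  refine M.abs_Delta_one_le hz hm hB (by positivity) (fun χ χ' => ?_) χ χ'
  refine le_add_left ?_
  calc _ ≤ ENNReal.ofReal (2 * B) * M.supLkh z * M.supLkh z :=
        mul_le_mul' (M.lintegral_ofReal_push_le hB χ z) (M.lik_le_supLkh χ' z)
    _ = _ := by
      rw [ENNReal.ofReal_mul (show 0 ≤ 2 * B by positivity),
        ENNReal.ofReal_pow ENNReal.toReal_nonneg, ENNReal.ofReal_toReal hz]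
      ring

/-- Forgetting of the initial measure, uniformly in the initial measures. -/
theorem PathControl.abs_Delta_div_le (h : M.PathControl r K D c C₀ y) (hD : MeasurableSet D)
    (hne : D.Nonempty) (hr : 0 < r) (hc : 0 ≤ c) (hρ : ρ < 1) (hρ0 : ρ ≠ 0)
    (hmix : M.IsMixing r K ρ (expE (-(48 * r * (25 * (c + 1)))))) {m : ℕ}
    (hE : 24 * r * (C₀ + 1) ≤ m) {f : X → ℝ} (hf : Measurable f) {B : ℝ} (hB0 : 0 ≤ B)
    (hB : ∀ x, |f x| ≤ B) (χ χ' : ProbabilityMeasure X) :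
    |M.Delta χ χ' (block y (-m) m) f (fun _ => 1)| / (M.supLkh (block y (-m) m)).toReal ^ 2 ≤
      6 * rate r ρ ^ m * B := by
  have hz : M.supLkh (block y (-m) m) ≠ ∞ :=
    ne_top_of_le_ne_top (h.majorant_ne_top _ _) (M.supLkh_le_majorant y (-m) m)
  have hsup := h.le_supLkh hD hne hr hc hE
  have hfm : Measurable fun x => ENNReal.ofReal (f x + B) :=
    (hf.add_const B).ennreal_ofReal
  have hfB : ∀ x, ENNReal.ofReal (f x + B) ≤ ENNReal.ofReal (2 * B) := fun x =>
    ENNReal.ofReal_le_ofReal (by have := (abs_le.1 (hB x)).2; linarith)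
  obtain ⟨e, he1, he2, hle⟩ := h.two_term (k := 0) hr hc hmix (by simpa using hE) hfm
    (b := fun _ => 1) measurable_const (s := ENNReal.ofReal (2 * B)) ENNReal.ofReal_ne_top
    ⟨max 1 (2 * B).toNNReal, fun x => (hfB x).trans (by
      rw [ENNReal.ofReal]; exact_mod_cast le_max_right _ _), fun x => by
      exact_mod_cast le_max_left _ _⟩ (fun x x' => by rw [mul_one]; exact hfB x)
  rw [add_zero] at he2
  have hρtop : ρ ≠ ∞ := (hρ.trans ENNReal.one_lt_top).ne
  have hβ : 0 ≤ rate r ρ ^ m := pow_nonneg (rate_pos r ρ).le m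
  refine div_le_of_le_mul₀ (by positivity) (by positivity) ?_
  refine M.abs_Delta_one_le hz hf hB (by positivity) (fun χ χ' => ?_) χ χ'
  have h1 := hle (χ : Measure X) (χ' : Measure X)
  simp only [add_zero] at h1
  have e1 : ∀ χ : ProbabilityMeasure X,
      ∫⁻ x, M.act y (-m) m (fun x => ENNReal.ofReal (f x + B)) x ∂(χ : Measure X) =
        ∫⁻ x, ENNReal.ofReal (f x + B) ∂M.push χ (block y (-m) m) := fun χ =>
    (M.lintegral_push y χ (-m) m hfm).symm
  rw [e1, e1, ← lik_eq, ← lik_eq, measure_univ, measure_univ, mul_one, mul_one, add_assoc] at h1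
  refine h1.trans (add_le_add_right ?_ _)
  have i1 : ∀ χ χ' : ProbabilityMeasure X,
      (∫⁻ x, ENNReal.ofReal (f x + B) ∂M.push χ (block y (-m) m)) *
        M.lik χ' (block y (-m) m) ≤ ENNReal.ofReal (2 * B) *
          (M.supLkh (block y (-m) m) * M.supLkh (block y (-m) m)) := fun χ χ' => by
    rw [← mul_assoc]
    exact mul_le_mul' (M.lintegral_ofReal_push_le hB χ _) (M.lik_le_supLkh χ' _)
  have i2 : ρ ^ e ≤ ENNReal.ofReal (rate r ρ ^ m) := by
    rw [← ENNReal.ofReal_toReal (ENNReal.pow_ne_top hρtop)]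
    exact ENNReal.ofReal_le_ofReal (pow_le_rate_pow hρ hρ0 he2)
  have i3 : expE (-(21 * (c + 1) * m)) ≤ ENNReal.ofReal (rate r ρ ^ m) *
      (M.supLkh (block y (-m) m) * M.supLkh (block y (-m) m)) := by
    calc expE (-(21 * (c + 1) * m)) ≤ expE (-(m : ℝ) +
          (-(4 * (c + 1) * m) + -(4 * (c + 1) * m))) := by
          refine expE_mono ?_
          have : (0 : ℝ) ≤ m := by positivity
          nlinarith [mul_nonneg hc this]
      _ = ENNReal.ofReal (Real.exp (-m)) * (expE (-(4 * (c + 1) * m)) *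
          expE (-(4 * (c + 1) * m))) := by rw [expE_add, expE_add]; rfl
      _ ≤ _ := by
          gcongr
          exact exp_neg_le_rate_pow r ρ m
  have i4 : expE (-(21 * (c + 1) * (m + ((0 : ℕ) : ℝ)))) = expE (-(21 * (c + 1) * m)) := by
    simp
  rw [i4]
  -- The symmetric term contributes twice `2B` and the error once `2B`, hence the constant `6`. The
  -- error is absorbed because `21 (c + 1)` exceeds `1` plus twice the rate `4 (c + 1)` of the lower
  -- bound for `‖L 1‖_∞`.
  calc _ ≤ ENNReal.ofReal (rate r ρ ^ m) *
        (ENNReal.ofReal (2 * B) * (M.supLkh (block y (-m) m) * M.supLkh (block y (-m) m)) +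
          ENNReal.ofReal (2 * B) * (M.supLkh (block y (-m) m) * M.supLkh (block y (-m) m))) +
        ENNReal.ofReal (rate r ρ ^ m) *
          (M.supLkh (block y (-m) m) * M.supLkh (block y (-m) m)) * ENNReal.ofReal (2 * B) :=
        add_le_add (mul_le_mul' i2 (add_le_add (i1 χ χ')
          ((mul_comm _ _).trans_le (i1 χ' χ)))) (mul_le_mul' i3 le_rfl)
    _ = _ := by
      rw [show 6 * rate r ρ ^ m * B = 3 * rate r ρ ^ m * (2 * B) by ring,
        ENNReal.ofReal_mul (show 0 ≤ 3 * rate r ρ ^ m * (2 * B) by positivity),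
        ENNReal.ofReal_mul (show 0 ≤ 3 * rate r ρ ^ m by positivity),
        ENNReal.ofReal_mul (show (0 : ℝ) ≤ 3 by norm_num), ENNReal.ofReal_pow ENNReal.toReal_nonneg,
        ENNReal.ofReal_toReal hz]
      rw [show ENNReal.ofReal 3 = 3 by simp]
      ring

end HMM

/-! ### Random constants and almost sure control -/

/-- Absorbing finitely many exceptional indices in a measurable random constant. -/
lemma exists_measurable_bound {Ω ι : Type*} [MeasurableSpace Ω] [Countable ι] {P : Measure Ω}
    {U : Ω → ℝ} (hU : Measurable U) {w : ι → ℕ} (hw : ∀ N, {i | w i ≤ N}.Finite) {β : ℝ}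
    (hβ : 0 < β) {b : ℝ} (hb : 0 ≤ b) {T : ι → Ω → ℝ} (hT : ∀ i, AEMeasurable (T i) P) :
    ∃ C : Ω → ℝ, Measurable C ∧ ∀ᵐ ω ∂P, b ≤ C ω ∧
      ∀ i, (w i : ℝ) < U ω → T i ω ≤ C ω * β ^ w i := by
  classical
  -- For each `ω` only finitely many indices satisfy `w i < U ω`, so the sum of the required
  -- constants is finite. Measurable versions of the `T i` make it a measurable function.
  set F : ι → Ω → ℝ≥0∞ := fun i => {ω | (w i : ℝ) < U ω}.indicator
    fun ω => ENNReal.ofReal (|(hT i).mk (T i) ω| / β ^ w i) with hF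
  have hFm : ∀ i, Measurable (F i) := fun i =>
    Measurable.indicator (((hT i).measurable_mk.abs.div_const _).ennreal_ofReal)
      (measurableSet_lt measurable_const hU)
  have hfin : ∀ ω, ∑' i, F i ω ≠ ∞ := by
    intro ω
    obtain ⟨N, hN⟩ := exists_nat_ge (U ω)
    rw [tsum_eq_sum (s := (hw N).toFinset)]
    · refine ENNReal.sum_ne_top.2 fun i _ => ?_
      simp only [hF, Set.indicator_apply]
      split_ifs <;> simp
    · intro i hi
      simp only [hF, Set.indicator_apply]
      rw [if_neg]
      intro hlt
      apply hi
      have : (w i : ℝ) ≤ N := (le_of_lt hlt).trans hN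
      simpa using (show w i ≤ N by exact_mod_cast this)
  refine ⟨fun ω => b + (∑' i, F i ω).toReal,
    measurable_const.add (Measurable.tsum hFm).ennreal_toReal, ?_⟩
  filter_upwards [ae_all_iff.2 fun i => (hT i).ae_eq_mk] with ω hω
  have h0 : 0 ≤ (∑' i, F i ω).toReal := ENNReal.toReal_nonneg
  refine ⟨by linarith, fun i hi => ?_⟩
  have h1 : F i ω = ENNReal.ofReal (|T i ω| / β ^ w i) := by
    simp only [hF]
    rw [Set.indicator_of_mem (show ω ∈ {ω | (w i : ℝ) < U ω} from hi), hω i]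
  have h2 := ENNReal.toReal_mono (hfin ω) (ENNReal.le_tsum (f := fun i => F i ω) i)
  rw [h1, ENNReal.toReal_ofReal (by positivity), div_le_iff₀ (by positivity)] at h2
  calc T i ω ≤ |T i ω| := le_abs_self _
    _ ≤ _ := h2
    _ ≤ _ := by gcongr; linarith

namespace HMM

variable {X S Ω : Type*} [MeasurableSpace X] [MeasurableSpace S] [MeasurableSpace Ω]
  {M : HMM X S} {P : Measure Ω} {Y : ℤ → Ω → S} {r : ℕ} {K : Set (Fin r → S)} {D : Set X}

/-- The Doeblin ratio is capped at `1/2`, so that `ρ = 1 - c²` is neither `1` nor `0`. A positive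
`ρ` is needed for the comparison of real powers that defines the rate. -/
lemma AssumptionA1.exists_isMixing (h : M.AssumptionA1 P Y r K D) {η : ℝ} :
    ∃ ρ : ℝ≥0∞, ρ < 1 ∧ ρ ≠ 0 ∧ M.IsMixing r K ρ (expE η) := by
  obtain ⟨C, εm, εp, lam, φ, h1, h2, h3⟩ := h.localDoeblin (Real.exp η).toNNReal
    (Real.toNNReal_pos.2 (Real.exp_pos _))
  set c : ℝ≥0∞ := min (⨅ z ∈ K, (εm z : ℝ≥0∞) / (εp z : ℝ≥0∞)) (1 / 2) with hc
  have hc0 : c ≠ 0 := (lt_min h3 (by simp)).ne'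
  have hc1 : c < 1 := (min_le_right _ _).trans_lt (by simp)
  have hcc : c * c < 1 := by
    calc c * c ≤ c * 1 := by gcongr
      _ = c := mul_one c
      _ < 1 := hc1
  refine ⟨1 - c * c, ENNReal.sub_lt_self (by simp) (by simp) (mul_ne_zero hc0 hc0),
    (tsub_pos_of_lt hcc).ne', C, εm, εp, lam, φ, c, h1, fun z hz => ?_, fun z hz => (h2 z hz).1,
    tsub_add_cancel_of_le hcc.le⟩
  exact (min_le_left _ _).trans (iInf₂_le z hz)

variable [IsProbabilityMeasure P]

/-- Almost every path is controlled. -/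
theorem exists_pathControl (hY : ∀ n, Measurable (Y n)) (hA1 : M.AssumptionA1 P Y r K D)
    (hA2 : M.AssumptionA2 P Y) :
    ∃ c : ℝ, 0 ≤ c ∧ ∃ U : Ω → ℝ, Measurable U ∧
      ∀ᵐ ω ∂P, M.PathControl r K D c (U ω) (fun n => Y n ω) := by
  classical
  have hpath : Measurable fun ω n => Y n ω := measurable_pi_lambda _ hY
  set V : ℤ → Ω → (Fin r → S) := fun n ω => block (fun j => Y j ω) (n * (r : ℤ)) r with hV
  have hVm : ∀ n, Measurable (V n) := fun n => (measurable_block _ _).comp hpath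
  have hVpath : Measurable fun ω n => V n ω := measurable_pi_lambda _ hVm
  have hV0 : V 0 = fun ω => block (fun j => Y j ω) 0 r := by ext ω; simp [hV]
  obtain ⟨c₁, hc₁, hc₁'⟩ : ∃ c₁ : ℝ, 0 ≤ c₁ ∧
      ∫⁻ ω, logPlus (M.supG (Y 0 ω)) ∂P < ENNReal.ofReal c₁ := by
    refine ⟨(∫⁻ ω, logPlus (M.supG (Y 0 ω)) ∂P).toReal + 1, by positivity, ?_⟩
    rw [ENNReal.lt_ofReal_iff_toReal_lt hA2.supG.2.ne]
    linarith
  obtain ⟨c₂, hc₂, hc₂'⟩ : ∃ c₂ : ℝ, 0 ≤ c₂ ∧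
      ∫⁻ ω, logMinus (⨅ x ∈ D, M.lkh (V 0 ω) x D) ∂P < ENNReal.ofReal c₂ := by
    rw [hV0]
    refine ⟨(∫⁻ ω, logMinus (⨅ x ∈ D, M.lkh (block (fun j => Y j ω) 0 r) x D) ∂P).toReal + 1,
      by positivity, ?_⟩
    rw [ENNReal.lt_ofReal_iff_toReal_lt hA1.minoration.2.ne]
    linarith
  -- The strict inequality `P(Z_0 ∈ K) > 2/3` is used here: the mean number of bad blocks lies
  -- strictly below the slope `1/3`, as the ergodic bound requires.
  have hc₃ : ∫⁻ ω, (Kᶜ).indicator (1 : (Fin r → S) → ℝ≥0∞) (V 0 ω) ∂P <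
      ENNReal.ofReal (1 / 3) := by
    have e1 : ∫⁻ ω, (Kᶜ).indicator (1 : (Fin r → S) → ℝ≥0∞) (V 0 ω) ∂P = P (V 0 ⁻¹' K)ᶜ := by
      rw [← lintegral_indicator_one (hVm 0 hA1.measurableSet_K).compl]
      rfl
    have e2 : 2 / 3 < P (V 0 ⁻¹' K) := by
      have := hA1.prob_K
      rwa [hV0]
    rw [e1, prob_compl_eq_one_sub (hVm 0 hA1.measurableSet_K)]
    refine ENNReal.sub_lt_of_lt_add prob_le_one ?_
    have e3 : ENNReal.ofReal (1 / 3) + 2 / 3 = 1 := by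
      rw [ENNReal.ofReal_div_of_pos (by norm_num), ENNReal.ofReal_one, ENNReal.ofReal_ofNat,
        ← ENNReal.add_div]
      norm_num
      exact ENNReal.div_self (by simp) (by simp)
    calc 1 = ENNReal.ofReal (1 / 3) + 2 / 3 := e3.symm
      _ < _ := ENNReal.add_lt_add_left ENNReal.ofReal_ne_top e2
  have hm₁ : AEMeasurable (fun u : ℤ → S => logPlus (M.supG (u 0))) (P.map fun ω n => Y n ω) := by
    refine AEMeasurable.comp_measurable (f := fun u : ℤ → S => u 0)
      (g := fun y => logPlus (M.supG y)) ?_ (measurable_pi_apply 0)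
    rw [Measure.map_map (measurable_pi_apply 0) hpath]
    exact hA2.supG.1
  have hm₂ : AEMeasurable (fun u : ℤ → (Fin r → S) => logMinus (⨅ x ∈ D, M.lkh (u 0) x D))
      (P.map fun ω n => V n ω) := by
    refine AEMeasurable.comp_measurable (f := fun u : ℤ → (Fin r → S) => u 0)
      (g := fun z => logMinus (⨅ x ∈ D, M.lkh z x D)) ?_ (measurable_pi_apply 0)
    rw [Measure.map_map (measurable_pi_apply 0) hVpath]
    have e1 : (fun u : ℤ → (Fin r → S) => u 0) ∘ (fun ω n => V n ω) =
        fun ω => block (fun j => Y j ω) 0 r := hV0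
    rw [e1]
    exact hA1.minoration.1
  have hm₃ : Measurable fun u : ℤ → (Fin r → S) =>
      (Kᶜ).indicator (1 : (Fin r → S) → ℝ≥0∞) (u 0) :=
    (measurable_one.indicator hA1.measurableSet_K.compl).comp (measurable_pi_apply 0)
  obtain ⟨U₁, hU₁, h₁⟩ := hA1.stationaryErgodic.exists_sum_shiftSeq_le hY hm₁ hc₁'
  obtain ⟨U₂, hU₂, h₂⟩ := IsStationaryErgodic.exists_sum_shiftSeq_le (V := V) hA1.blockErgodic
    hVm hm₂ hc₂'
  obtain ⟨U₃, hU₃, h₃⟩ := IsStationaryErgodic.exists_sum_shiftSeq_le (V := V) hA1.blockErgodic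
    hVm hm₃.aemeasurable hc₃
  refine ⟨c₁ + c₂, by positivity, fun ω => |U₁ ω| + |U₂ ω| + |U₃ ω|,
    (hU₁.abs.add hU₂.abs).add hU₃.abs, ?_⟩
  filter_upwards [h₁, h₂, h₃] with ω h₁ h₂ h₃
  have b₁ := le_abs_self (U₁ ω)
  have b₂ := le_abs_self (U₂ ω)
  have b₃ := le_abs_self (U₃ ω)
  have b₁' := abs_nonneg (U₁ ω)
  have b₂' := abs_nonneg (U₂ ω)
  have b₃' := abs_nonneg (U₃ ω)
  refine ⟨by positivity, fun p q => ?_, fun p q => ?_, fun p q => ?_⟩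
  · have hs := h₁.2 p q
    have h0 : (0 : ℝ) ≤ c₂ * (p + q) := by positivity
    calc M.majorant (fun n => Y n ω) (-p) (p + q)
        ≤ ∏ i ∈ Finset.range (p + q), expE (logPlus (M.supG (Y (-(p : ℤ) + i) ω))).toReal := by
          refine Finset.prod_le_prod' fun i _ => max_le ?_ (le_expE_logPlus ?_)
          · rw [← expE_zero]; exact expE_mono ENNReal.toReal_nonneg
          · simpa [shiftSeq] using h₁.1 (-(p : ℤ) + i)
      _ = expE (∑ i ∈ Finset.range (p + q), (logPlus (M.supG (Y (-(p : ℤ) + i) ω))).toReal) :=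
          (expE_sum _ _).symm
      _ ≤ _ := by
          refine expE_mono ?_
          simp only [shiftSeq, zero_add] at hs
          linarith
  · have hs := h₂.2 p q
    have h0 : (0 : ℝ) ≤ c₁ * (p + q) := by positivity
    calc _ ≤ expE (∑ i ∈ Finset.range (p + q),
            -(logMinus (⨅ x ∈ D, M.lkh (V (-(p : ℤ) + i) ω) x D)).toReal) := by
          refine expE_mono ?_
          rw [Finset.sum_neg_distrib]
          simp only [shiftSeq, zero_add] at hs
          linarith
      _ = ∏ i ∈ Finset.range (p + q),
            expE (-(logMinus (⨅ x ∈ D, M.lkh (V (-(p : ℤ) + i) ω) x D)).toReal) := expE_sum _ _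
      _ ≤ _ := Finset.prod_le_prod' fun i _ => expE_neg_logMinus_le (by
          simpa [shiftSeq] using h₂.1 (-(p : ℤ) + i))
  · have hs := h₃.2 p q
    have e1 : (badCount K (fun n => Y n ω) (-p) (p + q) : ℝ) = ∑ i ∈ Finset.range (p + q),
        ((Kᶜ).indicator (1 : (Fin r → S) → ℝ≥0∞) (V (-(p : ℤ) + i) ω)).toReal := by
      rw [badCount, Nat.cast_sum]
      refine Finset.sum_congr rfl fun i _ => ?_
      by_cases hK : V (-(p : ℤ) + i) ω ∈ K
      · rw [if_pos hK, Set.indicator_of_notMem (by simpa using hK)]; simp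
      · rw [if_neg hK, Set.indicator_of_mem (by simpa using hK)]; simp
    rw [e1]
    simp only [shiftSeq, zero_add] at hs
    linarith

/-- Almost every path is controlled at the start, for the initial laws of the class `ℳ(D, r)`. -/
theorem exists_initControl (hY : ∀ n, Measurable (Y n)) (hA1 : M.AssumptionA1 P Y r K D)
    {χ : ProbabilityMeasure X} (hχ : χ ∈ M.initClass P Y D r) :
    ∃ U : Ω → ℝ, Measurable U ∧ ∀ᵐ ω ∂P, 0 ≤ U ω ∧
      M.InitControl r D χ (U ω) (fun n => Y n ω) := by
  -- For each of the finitely many lengths `l`, integrability over the class gives at most linear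
  -- growth in `m`. Slope `1` is enough, since later rates are stated with `c + 1`.
  have h : ∀ l : Fin (r + 1), ∃ U : Ω → ℝ, Measurable U ∧ ∀ᵐ ω ∂P, ∀ m : ℕ,
      logMinus (M.push χ (block (shiftSeq (-(m : ℤ)) fun n => Y n ω) 0 l) D) < ∞ ∧
      (logMinus (M.push χ (block (shiftSeq (-(m : ℤ)) fun n => Y n ω) 0 l) D)).toReal ≤
        1 * m + U ω := fun l =>
    hA1.stationaryErgodic.exists_shiftSeq_neg_le hY
      (f := fun u => logMinus (M.push χ (block u 0 l) D))
      (measurable_logMinus.comp ((M.measurable_push χ hA1.measurableSet_D).comp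
        (measurable_block 0 l))) (hχ l (Nat.lt_succ_iff.1 l.2)) one_pos
  choose U hU hUω using h
  refine ⟨fun ω => ∑ l, |U l ω|, Finset.measurable_sum _ fun l _ => (hU l).abs, ?_⟩
  filter_upwards [ae_all_iff.2 hUω] with ω hω
  refine ⟨by positivity, fun l hl m => ?_⟩
  obtain ⟨h1, h2⟩ := hω ⟨l, Nat.lt_succ_iff.2 hl⟩ m
  simp only [block_shiftSeq, zero_add] at h1 h2
  refine (expE_mono ?_).trans (expE_neg_logMinus_le h1)
  have h3 := (le_abs_self _).trans (Finset.single_le_sum (f := fun l => |U l ω|)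
    (fun i _ => abs_nonneg _) (Finset.mem_univ ⟨l, Nat.lt_succ_iff.2 hl⟩))
  linarith

end HMM

namespace HMM

variable {X S Ω : Type*} [MeasurableSpace X] [MeasurableSpace S] [MeasurableSpace Ω] {M : HMM X S}

/-- The one-step predictive log-likelihood is at most `ln⁺ ‖g_y‖_∞`. -/
lemma logPredLik_le {y : ℤ → S} (hg : ∀ x y, 0 < M.g x y) (hy : ∀ j n, M.majorant y j n ≠ ∞)
    {k : ℕ} (hk : logPlus (M.supG (y k)) < ∞) (χ : ProbabilityMeasure X) (m : ℕ) :
    M.logPredLik χ (block y (-m) (m + k + 1)) ≤ (logPlus (M.supG (y k))).toReal := by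
  have hle : M.lik χ (block y (-m) (m + k + 1)) ≤
      expE (logPlus (M.supG (y k))).toReal * M.lik χ (block y (-m) (m + k)) := by
    rw [lik_block_succ, lik_eq,
      ← lintegral_const_mul _ (M.measurable_act _ _ _ measurable_const)]
    refine lintegral_mono fun x => ?_
    rw [← act_const_mul _ _ _ _ _ measurable_const]
    refine M.act_mono y _ _ (fun x' => ?_) x
    rw [mul_one]
    exact (le_iSup (fun x => (M.g x (y k) : ℝ≥0∞)) x').trans (le_expE_logPlus hk)
  have hfin : ∀ n, M.lik χ (block y (-m) n) ≠ ∞ := fun n =>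
    ne_top_of_le_ne_top (hy _ _) (M.push_univ_le y χ (-m) n)
  have hpos : ∀ n, 0 < (M.lik χ (block y (-m) n)).toReal := fun n =>
    ENNReal.toReal_pos (M.lik_pos y hg χ _ _).ne' (hfin n)
  have h1 := ENNReal.toReal_mono (ENNReal.mul_ne_top (expE_ne_top _) (hfin _)) hle
  rw [ENNReal.toReal_mul, toReal_expE, ← div_le_iff₀ (hpos _)] at h1
  rw [logPredLik, init_block, Real.log_le_iff_le_exp (div_pos (hpos _) (hpos _))]
  exact h1

lemma supLkh_pos (hg : ∀ x y, 0 < M.g x y) [Nonempty X] (y : ℤ → S) (j : ℤ) (n : ℕ) :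
    0 < M.supLkh (block y j n) := by
  obtain ⟨x⟩ := ‹Nonempty X›
  refine lt_of_lt_of_le ?_ (le_iSup (fun x => M.lkh (block y j n) x Set.univ) x)
  rw [← act_one]
  exact M.act_pos y hg _ _ measurable_const (by simp) x

lemma measurable_logPredLik_block {Y : ℤ → Ω → S} (hY : ∀ n, Measurable (Y n))
    (χ : ProbabilityMeasure X) (j : ℤ) (n : ℕ) :
    Measurable fun ω => M.logPredLik χ (block (fun i => Y i ω) j (n + 1)) :=
  (M.measurable_logPredLik χ).comp ((measurable_block j (n + 1)).comp (measurable_pi_lambda _ hY))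

end HMM

/-! ### Assembling the three estimates -/

theorem mainTheorem5 {X S Ω : Type*} [MeasurableSpace X] [MeasurableSpace.CountablyGenerated X]
    [MeasurableSpace S] [MeasurableSpace Ω] (M : HMM X S)
    (P : Measure Ω) [IsProbabilityMeasure P] (Y : ℤ → Ω → S) (hY : ∀ n, Measurable (Y n))
    (r : ℕ) (K : Set (Fin r → S)) (D : Set X)
    (hA1 : M.AssumptionA1 P Y r K D) (hA2 : M.AssumptionA2 P Y) :
    -- almost surely, all the likelihoods are positive and finite
    (∀ᵐ ω ∂P, ∀ (j : ℤ) (n : ℕ),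
      (∀ χ : ProbabilityMeasure X, 0 < M.lik χ (block (fun i => Y i ω) j n) ∧
        M.lik χ (block (fun i => Y i ω) j n) < ∞) ∧
      0 < M.supLkh (block (fun i => Y i ω) j n) ∧ M.supLkh (block (fun i => Y i ω) j n) < ∞) ∧
    ∃ β : ℝ, 0 < β ∧ β < 1 ∧
      -- (i)
      (∀ χ ∈ M.initClass P Y D r, ∀ χ' ∈ M.initClass P Y D r,
        ∃ C : Ω → ℝ, Measurable C ∧ ∀ᵐ ω ∂P, ∀ k m : ℕ, 1 ≤ k →
          ∀ χt ∈ M.nearSet (block (fun i => Y i ω) (-(m : ℤ)) (m + k + 1)) χ,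
            M.logPredLik χt (block (fun i => Y i ω) (-(m : ℤ)) (m + k + 1)) -
              M.logPredLik χ' (block (fun i => Y i ω) (-(m : ℤ)) (m + k + 1))
                ≤ C ω * β ^ (k + m)) ∧
      -- (ii)
      (∀ χ ∈ M.initClass P Y D r,
        ∃ C : Ω → ℝ, Measurable C ∧ ∀ᵐ ω ∂P, ∀ k m : ℕ, 1 ≤ k →
          |M.logPredLik χ (block (fun i => Y i ω) (-(m : ℤ)) (m + k + 1)) -
            M.logPredLik χ (block (fun i => Y i ω) (-(m : ℤ) - 1) (m + k + 2))|
              ≤ C ω * β ^ (k + m)) ∧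
      -- (iii)
      (∃ C : Ω → ℝ, Measurable C ∧ ∀ᵐ ω ∂P, ∀ m : ℕ, 1 ≤ m →
        ∀ (χ χ' : ProbabilityMeasure X) (h : X → ℝ), Measurable h → (∃ B, ∀ x, |h x| ≤ B) →
          |M.Delta χ χ' (block (fun i => Y i ω) (-(m : ℤ)) m) h (fun _ => 1)| /
              (M.supLkh (block (fun i => Y i ω) (-(m : ℤ)) m)).toReal ^ 2
            ≤ C ω * β ^ m * ⨆ x, |h x|) := by
  have hg := hA2.g_pos
  have hD := hA1.measurableSet_D
  have hne := hA1.nonempty_D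
  have hr := hA1.r_pos
  have hX : Nonempty X := ⟨hne.some⟩
  -- The order of choice matters: the deterministic growth rate `c` fixes `η`, then `η` gives `ρ`
  -- and with it `β`. Only the additive constants remain random, and `β` does not depend on the
  -- initial laws.
  obtain ⟨c, hc, U, hU, hctrl⟩ := HMM.exists_pathControl hY hA1 hA2
  obtain ⟨ρ, hρ, hρ0, hmix⟩ := hA1.exists_isMixing (η := -(48 * r * (25 * (c + 1))))
  have hρ1 : ρ.toReal < 1 := by
    have := (ENNReal.toReal_lt_toReal (hρ.trans ENNReal.one_lt_top).ne ENNReal.one_ne_top).2 hρ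
    simpa using this
  have hβ := HMM.rate_pos r ρ
  have hb : 0 ≤ 4 / (1 - ρ.toReal) := div_nonneg (by norm_num) (by linarith)
  have hw : ∀ N, {i : ℕ × ℕ | i.1 + i.2 ≤ N}.Finite := fun N =>
    ((Set.finite_Iic N).prod (Set.finite_Iic N)).subset fun i hi => by
      have hi' : i.1 + i.2 ≤ N := hi
      exact ⟨show i.1 ≤ N by omega, show i.2 ≤ N by omega⟩
  refine ⟨?_, HMM.rate r ρ, hβ, HMM.rate_lt_one hr hρ, fun χ hχ χ' hχ' => ?_, fun χ hχ => ?_, ?_⟩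
  · filter_upwards [hctrl] with ω h j n
    have hfin := h.majorant_ne_top j n
    exact ⟨fun χ => ⟨M.lik_pos _ hg χ j n, (M.push_univ_le _ χ j n).trans_lt hfin.lt_top⟩,
      HMM.supLkh_pos hg _ j n, (M.supLkh_le_majorant _ j n).trans_lt hfin.lt_top⟩
  · obtain ⟨U₁, hU₁, hω₁⟩ := HMM.exists_initControl hY hA1 hχ
    obtain ⟨U₂, hU₂, hω₂⟩ := HMM.exists_initControl hY hA1 hχ'
    -- On short windows the bound must hold for all measures of the near set at once. The term of
    -- `χt` is therefore replaced by `ln⁺ ‖g_{Y_k}‖_∞`, which leaves countably many random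
    -- variables. The norm is measurable only up to null sets, hence the almost everywhere versions.
    obtain ⟨C, hC, hCω⟩ := exists_measurable_bound (P := P) (ι := ℕ × ℕ)
      (w := fun i => i.1 + i.2) (U := fun ω => 24 * r * (U ω + U₁ ω + U₂ ω + 1))
      ((((hU.add hU₁).add hU₂).add_const 1).const_mul _) hw hβ hb
      (T := fun i ω => (logPlus (M.supG (Y i.1 ω))).toReal -
        M.logPredLik χ' (block (fun i => Y i ω) (-(i.2 : ℤ)) (i.2 + i.1 + 1)))
      (fun i => by
        refine AEMeasurable.sub (AEMeasurable.ennreal_toReal ?_)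
          (HMM.measurable_logPredLik_block hY χ' _ _).aemeasurable
        have h1 := hA2.supG.1
        rw [← hA1.stationaryErgodic.map_eq hY (i.1 : ℤ)] at h1
        exact h1.comp_measurable (hY _))
    have hplus : ∀ᵐ ω ∂P, ∀ k : ℕ, logPlus (M.supG (Y k ω)) < ∞ := by
      refine ae_all_iff.2 fun k => ?_
      have h1 : ∀ᵐ s ∂P.map (Y 0), logPlus (M.supG s) < ∞ :=
        ae_lt_top' hA2.supG.1 (by
          rw [lintegral_map' hA2.supG.1 (hY 0).aemeasurable]; exact hA2.supG.2.ne)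
      rw [← hA1.stationaryErgodic.map_eq hY (k : ℤ)] at h1
      exact ae_of_ae_map (hY _).aemeasurable h1
    refine ⟨C, hC, ?_⟩
    filter_upwards [hctrl, hω₁, hω₂, hCω, hplus] with ω h h₁ h₂ hCω hplus k m _ χt hχt
    have h0 := h.nonneg
    rcases lt_or_ge ((k + m : ℕ) : ℝ) (24 * r * (U ω + U₁ ω + U₂ ω + 1)) with hlt | hge
    · refine le_trans ?_ (hCω.2 (k, m) hlt)
      exact sub_le_sub_right (HMM.logPredLik_le hg h.majorant_ne_top (hplus k) χt m) _
    · have hge' : 24 * r * (U ω + U₁ ω + U₂ ω + 1) ≤ (m : ℝ) + k := by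
        push_cast at hge; linarith
      refine ((h.mono (by linarith [h₁.1, h₂.1])).logPredLik_sub_le hD hr hc hg hρ hρ0 hmix
        (h₁.2.mono (by linarith [h₂.1])) (h₂.2.mono (by linarith [h₁.1])) hge' hχt).trans ?_
      exact mul_le_mul_of_nonneg_right hCω.1 (by positivity)
  · obtain ⟨U₁, hU₁, hω₁⟩ := HMM.exists_initControl hY hA1 hχ
    obtain ⟨C, hC, hCω⟩ := exists_measurable_bound (P := P) (ι := ℕ × ℕ)
      (w := fun i => i.1 + i.2) (U := fun ω => 24 * r * (U ω + U₁ ω + 1))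
      (((hU.add hU₁).add_const 1).const_mul _) hw hβ hb
      (T := fun i ω => |M.logPredLik χ (block (fun i => Y i ω) (-(i.2 : ℤ)) (i.2 + i.1 + 1)) -
        M.logPredLik χ (block (fun i => Y i ω) (-(i.2 : ℤ) - 1) (i.2 + i.1 + 2))|)
      (fun i => ((HMM.measurable_logPredLik_block hY χ _ _).sub
        (HMM.measurable_logPredLik_block hY χ _ _)).abs.aemeasurable)
    refine ⟨C, hC, ?_⟩
    filter_upwards [hctrl, hω₁, hCω] with ω h h₁ hCω k m _
    have h0 := h.nonneg
    rcases lt_or_ge ((k + m : ℕ) : ℝ) (24 * r * (U ω + U₁ ω + 1)) with hlt | hge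
    · exact hCω.2 (k, m) hlt
    · have hge' : 24 * r * (U ω + U₁ ω + 1) ≤ (m : ℝ) + k := by
        push_cast at hge; linarith
      refine ((h.mono (by linarith [h₁.1])).abs_logPredLik_sub_le hD hr hc hg hρ hρ0 hmix
        (h₁.2.mono (by linarith)) hge').trans ?_
      exact mul_le_mul_of_nonneg_right hCω.1 (by positivity)
  · obtain ⟨C, hC, hCω⟩ := exists_measurable_bound (P := P) (ι := ℕ) (w := fun i => i)
      (U := fun ω => 24 * r * (U ω + 1)) ((hU.add_const 1).const_mul _)
      (fun N => Set.finite_Iic N) hβ (b := 6) (by norm_num) (T := fun _ _ => 2)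
      (fun _ => aemeasurable_const)
    refine ⟨C, hC, ?_⟩
    filter_upwards [hctrl, hCω] with ω h hCω m _ χ χ' f hf ⟨B, hB⟩
    have hbdd : BddAbove (Set.range fun x => |f x|) := ⟨B, by rintro _ ⟨x, rfl⟩; exact hB x⟩
    have hsup : ∀ x, |f x| ≤ ⨆ x, |f x| := fun x => le_ciSup hbdd x
    have hsup0 : 0 ≤ ⨆ x, |f x| := (abs_nonneg _).trans (hsup hne.some)
    rcases lt_or_ge (m : ℝ) (24 * r * (U ω + 1)) with hlt | hge
    · refine (M.abs_Delta_one_div_le (ne_top_of_le_ne_top (h.majorant_ne_top _ _)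
        (M.supLkh_le_majorant _ _ _)) hf hsup0 hsup χ χ').trans ?_
      exact mul_le_mul_of_nonneg_right (hCω.2 m hlt) hsup0
    · refine (h.abs_Delta_div_le hD hne hr hc hρ hρ0 hmix hge hf hsup0 hsup χ χ').trans ?_
      exact mul_le_mul_of_nonneg_right (mul_le_mul_of_nonneg_right hCω.1 (by positivity)) hsup0
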